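/- Let $k_1,k_2,k_3\in\mathbb Z_{\ge 0}$, let $\sigma$ be a permutation of $\{1,2,3\}$, and put $K=3+k_1+k_2+k_3$. Irreducible fractions are written $t=\frac ab$ with coprime $a,b\in\mathbb Z_{\ge0}$, where $\frac10=\infty$, and $\frac ab\oplus\frac cd=\frac{a+c}{b+d}$. **Generalized Cohn matrices.** The Farey tree is the binary tree with root $(\frac01,\frac11,\frac10)$ in which $(r,t,s)$ has the two children $(r,r\oplus t,t)$ and $(t,t\oplus s,s)$. The generalized Markov tree is the binary tree with root $((1,\sigma(1)),(k_{\sigma(2)}+2,\sigma(2)),(1,\sigma(3)))$ in which $((x,h),(y,i),(z,j))$ has the two children $$\Big((x,h),\big(\tfrac{x^2+k_jxy+y^2}{z},j\big),(y,i)\Big),\qquad \Big((y,i),\big(\tfrac{y^2+k_hyz+z^2}{x},h\big),(z,j)\Big).$$ If $(n_t,i_t)$ denotes the pair in this tree at the position of $t$ in the Farey tree, put $k_t=k_{i_t}$ and $D_t=\begin{bmatrix}k_t&k_tK\\0&k_t\end{bmatrix}$. Set $$C_{\frac01}=\begin{bmatrix}K&-Kk_{\sigma(1)}-1\\1&-k_{\sigma(1)}\end{bmatrix},\quad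 C_{\frac11}=\begin{bmatrix}K(k_{\sigma(2)}+2)-k_{\sigma(2)}-1&K-1\\k_{\sigma(2)}+2&1\end{bmatrix},\quad C_{\frac10}=\begin{bmatrix}K-1-k_{\sigma(3)}&K-2-k_{\sigma(3)}\\1&1\end{bmatrix},$$ and, for every vertex $(r,t,s)$ of the Farey tree, $C_{r\oplus t}=C_rC_t-D_s$ and $C_{t\oplus s}=C_tC_s-D_r$. **Generalized strongly admissible sequences.** Put $s(\frac10)=(1+k_{\sigma(1)}+k_{\sigma(2)},1)$. Let $t=\frac ab\in(0,\infty)$. Triangulate $\mathbb R^2$ by the unit grid lines and the lines of slope $-1$ through the lattice points. Let $\overline{L_t}$ be the segment from $(-\varepsilon,0)$ to $(b-\varepsilon,a)$, oriented in this direction, with $\varepsilon>0$ sufficiently small; the edge containing its left end point counts as crossed, the edge containing its right end point does not. Go along $\overline{L_t}$ and write down, in the order in which they are passed, the following signs: * for each triangle, one sign: $-$ if the piece of the triangle to the left of $\overline{L_t}$ is a quadrilateral, and $+$ otherwise; * for each crossed horizontal (resp. diagonal, vertical) edge, $k_{\sigma(1)}$ (resp. $k_{\sigma(2)}$, $k_{\sigma(3)}$)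 equal signs: $+$ if the midpoint of the edge is strictly to the right of $\overline{L_t}$, and $-$ otherwise. Then $s(t)=(a_1,\dots,a_\ell)$ is the sequence of lengths of the maximal blocks of equal consecutive signs; it does not depend on $\varepsilon$ once $\varepsilon$ is small enough. **Theorem.** For every irreducible fraction $t\in(0,\infty]$, the matrix $C_t$ and the sequence $s(t)=(a_1,\dots,a_\ell)$ are well defined, and $$C_t=\begin{bmatrix}a_1&1\\1&0\end{bmatrix}\begin{bmatrix}a_2&1\\1&0\end{bmatrix}\cdots\begin{bmatrix}a_\ell&1\\1&0\end{bmatrix}.$$ -/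

import Mathlib

namespace GenCohn

/-! ### The Farey tree, the generalized Markov tree and the generalized Cohn tree

A fraction `n / d` is the pair `(n, d)` of natural numbers, so that `1 / 0` stands for infinity.
A vertex of an infinite binary tree is addressed by a list of Booleans: `[]` is the root,
`true :: p` is the first (left) child and `false :: p` the second (right) child of the vertex `p`.
-/

/-- The mediant of two fractions. -/
def mediant (q r : ℕ × ℕ) : ℕ × ℕ := (q.1 + r.1, q.2 + r.2)

/-- The Farey tree, with root `(0/1, 1/1, 1/0)`. -/
def fareyTree : List Bool → (ℕ × ℕ) × (ℕ × ℕ) × (ℕ × ℕ)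
  | [] => ((0, 1), (1, 1), (1, 0))
  | true :: p =>
      let (r, t, _) := fareyTree p
      (r, mediant r t, t)
  | false :: p =>
      let (_, t, s) := fareyTree p
      (t, mediant t s, s)

/-- The generalized Markov tree of number-position pairs. The parameters `k₁, k₂, k₃` are
`k 0, k 1, k 2`, and `σ` permutes the three positions. All the divisions are exact. -/
def gmTree (k : Fin 3 → ℕ) (σ : Equiv.Perm (Fin 3)) :
    List Bool → (ℚ × Fin 3) × (ℚ × Fin 3) × (ℚ × Fin 3)
  | [] => ((1, σ 0), ((k (σ 1) : ℚ) + 2, σ 1), (1, σ 2))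
  | true :: p =>
      let ((a, h), (b, i), (c, j)) := gmTree k σ p
      ((a, h), ((a ^ 2 + k j * a * b + b ^ 2) / c, j), (b, i))
  | false :: p =>
      let ((a, h), (b, i), (c, j)) := gmTree k σ p
      ((b, i), ((b ^ 2 + k h * b * c + c ^ 2) / a, h), (c, j))

/-- The constant `3 + k₁ + k₂ + k₃`. -/
def kConst (k : Fin 3 → ℕ) : ℤ := 3 + k 0 + k 1 + k 2

/-- The matrix `D_r`, where `i` is the position `i_r` attached to the fraction `r`. -/
def dMatrix (k : Fin 3 → ℕ) (i : Fin 3) : Matrix (Fin 2) (Fin 2) ℤ :=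
  !![(k i : ℤ), k i * kConst k; 0, k i]

/-- The generalized Cohn tree: the triple `(C_r, C_t, C_s)` at the vertex whose Farey triple
is `(r, t, s)`. The positions `i_r`, `i_s` come from the same vertex of the generalized
Markov tree. -/
def cohnTree (k : Fin 3 → ℕ) (σ : Equiv.Perm (Fin 3)) :
    List Bool → Matrix (Fin 2) (Fin 2) ℤ × Matrix (Fin 2) (Fin 2) ℤ × Matrix (Fin 2) (Fin 2) ℤ
  | [] =>
      (!![kConst k, -(kConst k * k (σ 0)) - 1; 1, -(k (σ 0) : ℤ)],
       !![kConst k * (k (σ 1) + 2) - k (σ 1) - 1, kConst k - 1; (k (σ 1) : ℤ) + 2, 1],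
       !![kConst k - 1 - k (σ 2), kConst k - 2 - k (σ 2); 1, 1])
  | true :: p =>
      let (Cr, Ct, _) := cohnTree k σ p
      let (_, _, (_, is)) := gmTree k σ p
      (Cr, Cr * Ct - dMatrix k is, Ct)
  | false :: p =>
      let (_, Ct, Cs) := cohnTree k σ p
      let ((_, ir), _, _) := gmTree k σ p
      (Ct, Ct * Cs - dMatrix k ir, Cs)

/-- `M` is the generalized Cohn matrix `C_t`: it stands in the generalized Cohn tree at a
place at which `t` stands in the Farey tree. -/
def IsCohnMatrix (k : Fin 3 → ℕ) (σ : Equiv.Perm (Fin 3)) (t : ℕ × ℕ)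
    (M : Matrix (Fin 2) (Fin 2) ℤ) : Prop :=
  ∃ p : List Bool,
    ((fareyTree p).1 = t ∧ (cohnTree k σ p).1 = M) ∨
    ((fareyTree p).2.1 = t ∧ (cohnTree k σ p).2.1 = M) ∨
    ((fareyTree p).2.2 = t ∧ (cohnTree k σ p).2.2 = M)

/-! ### The triangulated plane

The plane is cut into unit squares by the integer grid, and each square into two triangles by
its diagonal of slope `-1`. -/

/-- The edges and triangles of the triangulation, named by the lower left corner of the grid
square; `horizontal` is the bottom side of that square and `vertical` is its left side. -/
inductive Cell
  | horizontal (x y : ℤ)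
  | diagonal (x y : ℤ)
  | vertical (x y : ℤ)
  | lowerTriangle (x y : ℤ)
  | upperTriangle (x y : ℤ)

/-- The points of an edge without its end points, or of a triangle without its boundary. -/
def Cell.points : Cell → Set (ℝ × ℝ)
  | .horizontal x y => {P | P.2 = y ∧ (x : ℝ) < P.1 ∧ P.1 < x + 1}
  | .diagonal x y => {P | P.1 + P.2 = x + y + 1 ∧ (x : ℝ) < P.1 ∧ P.1 < x + 1}
  | .vertical x y => {P | P.1 = x ∧ (y : ℝ) < P.2 ∧ P.2 < y + 1}
  | .lowerTriangle x y => {P | (x : ℝ) < P.1 ∧ (y : ℝ) < P.2 ∧ P.1 + P.2 < x + y + 1}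
  | .upperTriangle x y => {P | P.1 < (x : ℝ) + 1 ∧ P.2 < (y : ℝ) + 1 ∧ (x : ℝ) + y + 1 < P.1 + P.2}

/-! ### The shifted segment and its signs -/

/-- For `t = a / b`, the parametrization, from left to right, of the segment from `(0, 0)` to
`(b, a)` shifted to the left by `ε`. -/
def shiftedSegment (a b : ℕ) (ε τ : ℝ) : ℝ × ℝ := (τ * b - ε, τ * a)

/-- The parameters at which the shifted segment is in the cell `c`. The left end point, which
is on a horizontal edge, counts as a crossing of that edge; the right end point does not. -/
def passTimes (a b : ℕ) (ε : ℝ) (c : Cell) : Set ℝ :=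
  {τ | 0 ≤ τ ∧ τ < 1 ∧ shiftedSegment a b ε τ ∈ c.points}

/-- `l` lists the cells through which the shifted segment passes, each exactly once, in the
order in which it passes through them. -/
def IsItinerary (a b : ℕ) (ε : ℝ) (l : List Cell) : Prop :=
  (∀ c : Cell, c ∈ l ↔ (passTimes a b ε c).Nonempty) ∧
  l.Pairwise fun c d => ∀ τ ∈ passTimes a b ε c, ∀ τ' ∈ passTimes a b ε d, τ < τ'

/-- Positive on the left of the oriented line that carries the shifted segment, negative on its
right and zero on it: the determinant of the direction `(b, a)` and the vector from the left end
point `(-ε, 0)` to `P`. -/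
def side (a b : ℕ) (ε : ℝ) (P : ℝ × ℝ) : ℝ := b * P.2 - a * (P.1 + ε)

open Classical in
/-- The sign of an edge with midpoint `P`: plus (`true`) if `P` is strictly on the right,
minus (`false`) otherwise. -/
noncomputable def edgeSign (a b : ℕ) (ε : ℝ) (P : ℝ × ℝ) : Bool :=
  decide (side a b ε P < 0)

open Classical in
/-- The sign of a crossed triangle with vertices `P`, `Q`, `R`: minus (`false`) if its left-hand
piece is a quadrilateral, that is, if two of the vertices are on the left; plus (`true`)
otherwise. -/
noncomputable def triangleSign (a b : ℕ) (ε : ℝ) (P Q R : ℝ × ℝ) : Bool :=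
  decide (([P, Q, R].filter fun X => 0 < side a b ε X).length ≠ 2)

/-- The signs given to a cell by the edge-crossing and triangle-crossing rules: `k_{σ(1)}`,
`k_{σ(2)}`, `k_{σ(3)}` equal signs for horizontal, diagonal, vertical edges, one sign for a
triangle. -/
noncomputable def cellSigns (k : Fin 3 → ℕ) (σ : Equiv.Perm (Fin 3)) (a b : ℕ) (ε : ℝ) :
    Cell → List Bool
  | .horizontal x y => List.replicate (k (σ 0)) (edgeSign a b ε ((x : ℝ) + 1 / 2, (y : ℝ)))
  | .diagonal x y => List.replicate (k (σ 1)) (edgeSign a b ε ((x : ℝ) + 1 / 2, (y : ℝ) + 1 / 2))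
  | .vertical x y => List.replicate (k (σ 2)) (edgeSign a b ε ((x : ℝ), (y : ℝ) + 1 / 2))
  | .lowerTriangle x y =>
      [triangleSign a b ε ((x : ℝ), (y : ℝ)) ((x : ℝ) + 1, (y : ℝ)) ((x : ℝ), (y : ℝ) + 1)]
  | .upperTriangle x y =>
      [triangleSign a b ε ((x : ℝ) + 1, (y : ℝ)) ((x : ℝ), (y : ℝ) + 1)
        ((x : ℝ) + 1, (y : ℝ) + 1)]

/-- The lengths of the maximal blocks of equal consecutive signs. -/
def runLengths (w : List Bool) : List ℕ := (w.splitBy (· == ·)).map List.length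

open Filter Topology in
/-- `s` is the generalized strongly admissible sequence `s(t)`, where `t = t.1 / t.2`. -/
def IsStronglyAdmissible (k : Fin 3 → ℕ) (σ : Equiv.Perm (Fin 3)) (t : ℕ × ℕ) (s : List ℕ) :
    Prop :=
  if t.1 = 0 then s = [1 + k (σ 1) + k (σ 2), 1]
  else if t.2 = 0 then s = [1 + k (σ 0) + k (σ 1), 1]
  else ∀ᶠ ε : ℝ in 𝓝[>] 0, ∃ l : List Cell,
    IsItinerary t.1 t.2 ε l ∧ s = runLengths (l.flatMap (cellSigns k σ t.1 t.2 ε))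

/-- The product of the continued fraction matrices of the entries of `s`. -/
def cfMatrix (s : List ℕ) : Matrix (Fin 2) (Fin 2) ℤ :=
  (s.map fun a => !![(a : ℤ), 1; 1, 0]).prod

end GenCohn

namespace GenCohn
/-! ### Unipotent matrices and words -/

/-! Read a minus sign as U = `upMat 1` and a plus sign as L = `loMat 1`. With S = `swapMat`, the
matrix `!![n, 1; 1, 0]` is both U^n S and S L^n, so for a word from a minus to a plus the continued
fraction matrix of the run lengths is the plain product of the signs (`cfMatrix_runLengths`). It
remains to show that these products obey the Cohn recursion.

The signs in the m-th crossed square are thresholds on the residue of `m * a` modulo `a + b`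
(`flatMap_cellSigns_squareCells`). Conjugation by `upMat (1 + k (σ 0))` moves the signs before the
first diagonal to the end and leaves a product of `2 * (a + b)` letters (`wordMat_signWord`).

For Farey neighbours the concatenated letters agree with those of the mediant except at the middle
one, where the unshifted segment bisects an edge: there the mediant has k plus signs and the
concatenation k minus signs. As U^k - L^k = kJ with J = `sympMat`, the two products differ by k P J
Q, where P and Q are the letters before and after the middle. The half-turn about the middle of the
segment reverses signs, and U^n J L^n = L^n J U^n = J, so symmetric letters cancel around J. Only
the first two letters and the last one survive, and they collapse to U^K (`letterProd_mediant`).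
Here k belongs to the parity class of the mediant, which is the position recorded by the Markov tree
(`gmTree_position`), so the correction is the matrix D of the recursion. Induction on the tree
(`cohnTree_eq`) finishes the proof; the Markov numbers themselves play no role. -/

/-- The upper unipotent matrix with corner entry `n`. -/
def upMat (n : ℤ) : Matrix (Fin 2) (Fin 2) ℤ := !![1, n; 0, 1]

/-- The lower unipotent matrix with corner entry `n`. -/
def loMat (n : ℤ) : Matrix (Fin 2) (Fin 2) ℤ := !![1, 0; n, 1]

/-- The standard symplectic matrix. -/
def sympMat : Matrix (Fin 2) (Fin 2) ℤ := !![0, 1; -1, 0]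

/-- The matrix exchanging the two coordinates. -/
def swapMat : Matrix (Fin 2) (Fin 2) ℤ := !![0, 1; 1, 0]

theorem upMat_mul (m n : ℤ) : upMat m * upMat n = upMat (m + n) := by
  simp [upMat, add_comm]

theorem loMat_mul (m n : ℤ) : loMat m * loMat n = loMat (m + n) := by
  simp [loMat]

theorem upMat_zero : upMat 0 = 1 := by simp [upMat, Matrix.one_fin_two]

theorem loMat_zero : loMat 0 = 1 := by simp [loMat, Matrix.one_fin_two]

theorem upMat_symp_loMat (n : ℤ) : upMat n * sympMat * loMat n = sympMat := by
  simp [upMat, loMat, sympMat]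

theorem loMat_symp_upMat (n : ℤ) : loMat n * sympMat * upMat n = sympMat := by
  simp [upMat, loMat, sympMat]

theorem upMat_sub_loMat (n : ℤ) : upMat n - loMat n = n • sympMat := by
  ext i j
  fin_cases i <;> fin_cases j <;> simp [upMat, loMat, sympMat]

theorem loMat_symp_loMat : loMat 1 * sympMat * loMat 1 = upMat 1 := by
  simp [upMat, loMat, sympMat]

theorem swapMat_mul_self : swapMat * swapMat = 1 := by
  simp [swapMat, Matrix.one_fin_two]

/-- The matrix of a sign: the upper unipotent for minus, the lower one for plus. -/
def signMat (x : Bool) : Matrix (Fin 2) (Fin 2) ℤ := if x then loMat 1 else upMat 1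

/-- The product of the matrices of the signs of a word. -/
def wordMat (w : List Bool) : Matrix (Fin 2) (Fin 2) ℤ := (w.map signMat).prod

theorem wordMat_nil : wordMat [] = 1 := rfl

theorem wordMat_append (v w : List Bool) : wordMat (v ++ w) = wordMat v * wordMat w := by
  simp [wordMat]

theorem wordMat_cons (x : Bool) (w : List Bool) : wordMat (x :: w) = signMat x * wordMat w := by
  simp [wordMat]

theorem wordMat_replicate (n : ℕ) (x : Bool) :
    wordMat (List.replicate n x) = if x then loMat n else upMat n := by
  induction n with
  | zero => cases x <;> simp [wordMat_nil, upMat_zero, loMat_zero]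
  | succ n ih =>
    rw [List.replicate_succ, wordMat_cons, ih]
    cases x <;> simp [signMat, upMat_mul, loMat_mul, add_comm]

theorem wordMat_flatMap {α : Type*} (l : List α) (f : α → List Bool) :
    wordMat (l.flatMap f) = (l.map fun x => wordMat (f x)).prod := by
  induction l with
  | nil => rfl
  | cons x l ih => simp [List.flatMap_cons, wordMat_append, ih]

/-! ### Run lengths and continued fractions -/

theorem continuant_eq_signs (n : ℕ) (x : Bool) :
    !![(n : ℤ), 1; 1, 0] =
      (if x then swapMat else 1) * wordMat (List.replicate n x) * (if x then 1 else swapMat) := by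
  rw [wordMat_replicate]
  cases x <;> simp [swapMat, upMat, loMat]

/-- The first sign is left free for the induction. Signs of consecutive runs alternate, so the S
after a minus run cancels the S before the next plus run, and a final plus run leaves no S behind.
-/
theorem cfMatrix_map_length (L : List (List Bool)) (x : Bool) (hL : [] ∉ L)
    (hconst : ∀ m ∈ L, m.IsChain (· = ·))
    (hne : L.IsChain fun u v => ∃ hu hv, u.getLast hu ≠ v.head hv)
    (hhead : L.flatten.head? = some x) (hlast : L.flatten.getLast? = some true) :
    cfMatrix (L.map List.length) = (if x then swapMat else 1) * wordMat L.flatten := by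
  induction L generalizing x with
  | nil => simp at hhead
  | cons u L ih =>
    have hu : u ≠ [] := fun h => hL (by simp [h])
    obtain ⟨y, u', rfl⟩ := List.exists_cons_of_ne_nil hu
    have hyx : y = x := by simpa using hhead
    subst hyx
    have hrep : y :: u' = List.replicate (u'.length + 1) y := by
      have h := hconst (y :: u') (by simp)
      rw [List.isChain_iff_pairwise] at h
      rw [List.replicate_succ, List.eq_replicate_iff.2 ⟨rfl, fun z hz => (List.rel_of_pairwise_cons h hz).symm⟩]
      simp
    have hcf : cfMatrix (((y :: u') :: L).map List.length) =
        !![((u'.length + 1 : ℕ) : ℤ), 1; 1, 0] * cfMatrix (L.map List.length) := by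
      simp [cfMatrix]
    rw [hcf, continuant_eq_signs _ y, List.flatten_cons, wordMat_append, ← hrep]
    rcases L with _ | ⟨v, L⟩
    · have : y = true := by
        rw [hrep] at hlast
        simpa [List.getLast?_replicate] using hlast
      subst this
      simp [cfMatrix, wordMat_nil]
    · have hv : v ≠ [] := fun h => hL (by simp [h])
      obtain ⟨z, v', rfl⟩ := List.exists_cons_of_ne_nil hv
      have hyz : z = !y := by
        obtain ⟨⟨h1, h2, h3⟩, -⟩ := List.isChain_cons_cons.1 hne
        have : (y :: u').getLast h1 = y := by
          have hall : ∀ x ∈ y :: u', x = y := fun x hx => by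
            rw [hrep] at hx
            exact List.eq_of_mem_replicate hx
          exact hall _ (List.getLast_mem h1)
        rw [this] at h3
        revert h3
        cases y <;> cases z <;> simp
      rw [ih z (fun h => hL (List.mem_cons_of_mem _ h))
        (fun m hm => hconst m (List.mem_cons_of_mem _ hm)) (List.isChain_cons_cons.1 hne).2
        (by simp) (by rwa [List.flatten_cons, List.getLast?_append_of_ne_nil _ (by simp)] at hlast),
        hyz]
      cases y
      · simp [mul_assoc, ← mul_assoc swapMat swapMat, swapMat_mul_self]
      · simp [mul_assoc]

/-- The continued fraction matrix of the run lengths of a word from a minus to a plus. -/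
theorem cfMatrix_runLengths (w : List Bool) (hhead : w.head? = some false)
    (hlast : w.getLast? = some true) : cfMatrix (runLengths w) = wordMat w := by
  have h := cfMatrix_map_length (w.splitBy (· == ·)) false (List.nil_notMem_splitBy _ _)
    (fun m hm => by simpa using List.isChain_of_mem_splitBy hm)
    (by
      refine (List.isChain_getLast_head_splitBy (· == ·) w).imp ?_
      rintro u v ⟨hu, hv, h⟩
      exact ⟨hu, hv, by simpa using h⟩)
    (by simpa using hhead) (by simpa using hlast)
  simpa [runLengths] using h
/-! ### Ordered products of matrices -/

/-- The ordered product `f 0 * f 1 * ⋯ * f (n - 1)`. -/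
def seqProd {M : Type*} [Monoid M] (f : ℕ → M) : ℕ → M
  | 0 => 1
  | n + 1 => seqProd f n * f n

/-- The ordered product `f (n - 1) * ⋯ * f 1 * f 0`. -/
def revProd {M : Type*} [Monoid M] (f : ℕ → M) : ℕ → M
  | 0 => 1
  | n + 1 => f n * revProd f n

section Products

variable {M : Type*} [Monoid M]

theorem seqProd_add (f : ℕ → M) (m n : ℕ) :
    seqProd f (m + n) = seqProd f m * seqProd (fun i => f (m + i)) n := by
  induction n with
  | zero => simp [seqProd]
  | succ n ih => rw [← add_assoc, seqProd, ih, seqProd, mul_assoc]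

theorem seqProd_congr {f g : ℕ → M} {n : ℕ} (h : ∀ i < n, f i = g i) :
    seqProd f n = seqProd g n := by
  induction n with
  | zero => rfl
  | succ n ih => rw [seqProd, seqProd, ih fun i hi => h i (by omega), h n (by omega)]

theorem seqProd_succ' (f : ℕ → M) (n : ℕ) :
    seqProd f (n + 1) = f 0 * seqProd (fun i => f (i + 1)) n := by
  rw [add_comm, seqProd_add]
  simp [seqProd, add_comm]

theorem seqProd_eq_revProd (f : ℕ → M) (n : ℕ) :
    seqProd f n = revProd (fun i => f (n - 1 - i)) n := by
  induction n generalizing f with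
  | zero => rfl
  | succ n ih =>
    rw [seqProd_succ', revProd, ih]
    have h0 : n + 1 - 1 - n = 0 := by omega
    rw [h0]
    congr 1
    have hcongr : ∀ m ≤ n, revProd (fun i => f (n - 1 - i + 1)) m =
        revProd (fun i => f (n + 1 - 1 - i)) m := by
      intro m
      induction m with
      | zero => intro; rfl
      | succ m ihm =>
        intro hm
        rw [revProd, revProd, ihm (by omega)]
        congr 2
        omega
    exact hcongr n le_rfl

theorem list_prod_range_eq_seqProd (f : ℕ → M) (n : ℕ) :
    ((List.range n).map f).prod = seqProd f n := by
  induction n with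
  | zero => rfl
  | succ n ih => rw [List.range_succ, List.map_append, List.prod_append, ih]; simp [seqProd]

theorem seqProd_two_mul (f : ℕ → M) (n : ℕ) :
    seqProd f (2 * n) = seqProd (fun i => f (2 * i) * f (2 * i + 1)) n := by
  induction n with
  | zero => rfl
  | succ n ih => rw [show 2 * (n + 1) = 2 * n + 1 + 1 by ring, seqProd, seqProd, seqProd, ih, mul_assoc]

/-- A cyclic shift by one factor. When `p n = p 0` it says that the two products are conjugate by `p
0`. -/
theorem seqProd_mul_telescope (p q : ℕ → M) (n : ℕ) :
    seqProd (fun i => p i * q i) n * p n = p 0 * seqProd (fun i => q i * p (i + 1)) n := by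
  induction n with
  | zero => simp [seqProd]
  | succ n ih => rw [seqProd, seqProd, ← mul_assoc (p 0), ← ih]; simp only [mul_assoc]

theorem seqProd_mul_mul_revProd {g h : ℕ → M} {J : M} {n : ℕ}
    (H : ∀ i < n, g i * J * h i = J) : seqProd g n * J * revProd h n = J := by
  induction n with
  | zero => simp [seqProd, revProd]
  | succ n ih =>
    calc seqProd g (n + 1) * J * revProd h (n + 1)
        = seqProd g n * (g n * J * h n) * revProd h n := by simp only [seqProd, revProd, mul_assoc]
      _ = J := by rw [H n (by omega), ih fun i hi => H i (by omega)]

theorem seqProd_mul_mul_seqProd {g h : ℕ → M} {J : M} {n : ℕ}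
    (H : ∀ i < n, g i * J * h (n - 1 - i) = J) : seqProd g n * J * seqProd h n = J := by
  rw [seqProd_eq_revProd h]
  exact seqProd_mul_mul_revProd H

end Products

/-! ### The letters of the sign word of a fraction

Here `d` is the residue of `m * a` modulo `a + b`, which describes the position of the line in the
`m`-th square that it crosses. -/

/-- The matrix of the signs of a diagonal edge. -/
def diagLetter (kD a b d : ℕ) : Matrix (Fin 2) (Fin 2) ℤ :=
  if 2 * d < a + b then upMat kD else loMat kD

/-- The matrix of the signs of the upper triangle of a square, of the next edge, and of the next
lower triangle. -/
def sideLetter (kH kV a b d : ℕ) : Matrix (Fin 2) (Fin 2) ℤ :=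
  if d < b then upMat 1 * (if 2 * d < b then upMat kV else loMat kV) * loMat 1
  else loMat 1 * (if 2 * d < a + 2 * b then upMat kH else loMat kH) * upMat 1

/-- The letters of the sign word, without the signs before the first diagonal. -/
def letter (kH kD kV a b n : ℕ) : Matrix (Fin 2) (Fin 2) ℤ :=
  if n % 2 = 0 then diagLetter kD a b (n / 2 * a % (a + b))
  else sideLetter kH kV a b (n / 2 * a % (a + b))

/-- The product of the letters of a fraction. -/
def letterProd (kH kD kV a b : ℕ) : Matrix (Fin 2) (Fin 2) ℤ :=
  seqProd (letter kH kD kV a b) (2 * (a + b))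

/-- The value at the parity class of the fraction `a / b`, among `kH` (even numerator),
`kV` (even denominator) and `kD` (both odd). -/
def parityVal {α : Type*} (kH kD kV : α) (q : ℕ × ℕ) : α :=
  if q.1 % 2 = 0 then kH else if q.2 % 2 = 0 then kV else kD

section Letters

variable (kH kD kV : ℕ)

theorem letter_even (a b m : ℕ) :
    letter kH kD kV a b (2 * m) = diagLetter kD a b (m * a % (a + b)) := by
  simp [letter]

theorem letter_odd (a b m : ℕ) :
    letter kH kD kV a b (2 * m + 1) = sideLetter kH kV a b (m * a % (a + b)) := by
  have h1 : (2 * m + 1) % 2 = 1 := by omega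
  have h2 : (2 * m + 1) / 2 = m := by omega
  simp [letter, h1, h2]

theorem mod_eq_of_int {m a c d : ℕ} {Y : ℤ} (h : (m * a : ℤ) = c * Y + d) (hd : d < c) :
    m * a % c = d := by
  have h1 : ((m * a % c : ℕ) : ℤ) = d := by
    push_cast
    rw [h, Int.mul_add_emod_self_left, Int.emod_eq_of_lt (by omega) (by omega)]
  exact_mod_cast h1

/-- Complementary residues lie on opposite sides of the threshold unless they tie, so one letter is
a power of U and the other the same power of L. -/
theorem diagLetter_symp {a b d d' : ℕ} (hd : d + d' = a + b) (hne : 2 * d ≠ a + b) :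
    diagLetter kD a b d * sympMat * diagLetter kD a b d' = sympMat := by
  unfold diagLetter
  split_ifs
  · omega
  · exact upMat_symp_loMat _
  · exact loMat_symp_upMat _
  · omega

theorem sideLetter_symp_left {a b d d' : ℕ} (hd : d + d' = b) (hdb : d < b) (hdb' : d' < b)
    (hne : 2 * d ≠ b) :
    sideLetter kH kV a b d * sympMat * sideLetter kH kV a b d' = sympMat := by
  unfold sideLetter
  rw [if_pos hdb, if_pos hdb']
  -- The triangle signs next to J cancel first, then the edge signs, then the outer triangle signs.
  have key : ∀ X X' : Matrix (Fin 2) (Fin 2) ℤ, X * sympMat * X' = sympMat →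
      upMat 1 * X * loMat 1 * sympMat * (upMat 1 * X' * loMat 1) = sympMat := fun X X' h => by
    calc _ = upMat 1 * (X * (loMat 1 * sympMat * upMat 1) * X') * loMat 1 := by
            simp only [mul_assoc]
      _ = sympMat := by rw [loMat_symp_upMat, h, upMat_symp_loMat]
  apply key
  split_ifs
  · omega
  · exact upMat_symp_loMat _
  · exact loMat_symp_upMat _
  · omega

theorem sideLetter_symp_right {a b d d' : ℕ} (hd : d + d' = a + 2 * b) (hdb : b ≤ d)
    (hdb' : b ≤ d') (hne : 2 * d ≠ a + 2 * b) :
    sideLetter kH kV a b d * sympMat * sideLetter kH kV a b d' = sympMat := by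
  unfold sideLetter
  rw [if_neg hdb.not_gt, if_neg hdb'.not_gt]
  have key : ∀ X X' : Matrix (Fin 2) (Fin 2) ℤ, X * sympMat * X' = sympMat →
      loMat 1 * X * upMat 1 * sympMat * (loMat 1 * X' * upMat 1) = sympMat := fun X X' h => by
    calc _ = loMat 1 * (X * (upMat 1 * sympMat * loMat 1) * X') * upMat 1 := by
            simp only [mul_assoc]
      _ = sympMat := by rw [upMat_symp_loMat, h, loMat_symp_upMat]
  apply key
  split_ifs
  · omega
  · exact upMat_symp_loMat _
  · exact loMat_symp_upMat _
  · omega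

/-- If `a + b` divides a multiple `x * a`, where `a` and `b` are coprime, then it divides `x`. -/
theorem dvd_of_int_eq {a b : ℕ} (hab : Nat.Coprime a b) {x z : ℤ}
    (h : x * a = (a + b : ℕ) * z) : ((a + b : ℕ) : ℤ) ∣ x := by
  have hc : IsCoprime ((a + b : ℕ) : ℤ) (a : ℤ) := by
    rw [Nat.isCoprime_iff_coprime]
    simpa [Nat.coprime_comm] using hab
  exact hc.dvd_of_dvd_mul_right ⟨z, h⟩

theorem int_eq_of_dvd {c x : ℤ} (h : c ∣ x) (h0 : 0 < x) (h1 : x < 2 * c) : x = c := by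
  obtain ⟨k, rfl⟩ := h
  have hc : 0 < c := by omega
  have hk0 : 0 < k := pos_of_mul_pos_right h0 hc.le
  have hk1 : k < 2 := by nlinarith
  obtain rfl : k = 1 := by omega
  ring

/-- The letters at positions symmetric about the middle cancel. -/
theorem letter_symp_letter {a b : ℕ} (hab : Nat.Coprime a b) {n : ℕ}
    (hn : 2 ≤ n) (hn' : n + 2 ≤ 2 * (a + b)) (hne : n ≠ a + b) :
    letter kH kD kV a b n * sympMat * letter kH kD kV a b (2 * (a + b) - n) = sympMat := by
  have hc : 0 < a + b := by omega
  obtain ⟨m, hm⟩ := Nat.even_or_odd' n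
  have hd := Nat.mod_lt (m * a) hc
  have hma : (m * a : ℤ) = (a + b : ℕ) * ((m * a / (a + b) : ℕ) : ℤ) + (m * a % (a + b) : ℕ) := by
    exact_mod_cast (Nat.div_add_mod (m * a) (a + b)).symm
  rcases hm with rfl | rfl
  · rw [letter_even, show 2 * (a + b) - 2 * m = 2 * (a + b - m) by omega, letter_even]
    generalize m * a % (a + b) = d at *
    generalize ((m * a / (a + b) : ℕ) : ℤ) = Y at *
    have hd0 : d ≠ 0 := by
      rintro rfl
      have := Int.le_of_dvd (by omega) (dvd_of_int_eq hab (x := m) (z := Y) (by simpa using hma))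
      omega
    -- A tie would make `a + b` divide `2 * m`, which is the excluded middle position.
    have h2d : 2 * d ≠ a + b := by
      intro h
      have h' : (2 * d : ℤ) = (a + b : ℕ) := by exact_mod_cast h
      have := int_eq_of_dvd (dvd_of_int_eq hab (x := 2 * m) (z := 2 * Y + 1)
        (by linear_combination 2 * hma + h')) (by omega) (by omega)
      omega
    rw [mod_eq_of_int (d := a + b - d) (Y := a - Y - 1) _ (by omega)]
    · exact diagLetter_symp _ (by omega) h2d
    · rw [Nat.cast_sub (by omega), Nat.cast_sub (by omega)]
      push_cast at hma ⊢
      linear_combination -hma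
  · rw [letter_odd, show 2 * (a + b) - (2 * m + 1) = 2 * (a + b - 1 - m) + 1 by omega, letter_odd]
    generalize m * a % (a + b) = d at *
    generalize ((m * a / (a + b) : ℕ) : ℤ) = Y at *
    have hcast : ((a + b - 1 - m : ℕ) : ℤ) = a + b - 1 - m := by omega
    by_cases hdb : d < b
    · have hd0 : d ≠ 0 := by
        rintro rfl
        have := Int.le_of_dvd (by omega) (dvd_of_int_eq hab (x := m) (z := Y) (by simpa using hma))
        omega
      rw [mod_eq_of_int (d := b - d) (Y := a - Y - 1) _ (by omega)]
      · refine sideLetter_symp_left _ _ (by omega) hdb (by omega) fun h => ?_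
        have h' : (2 * d : ℤ) = b := by exact_mod_cast h
        have := int_eq_of_dvd (dvd_of_int_eq hab (x := 2 * m + 1) (z := 2 * Y + 1)
          (by push_cast at hma ⊢; linear_combination 2 * hma + h')) (by omega) (by omega)
        omega
      · rw [hcast, Nat.cast_sub (by omega)]
        push_cast at hma ⊢
        linear_combination -hma
    · have hdb' : d ≠ b := by
        rintro rfl
        have := Int.le_of_dvd (by omega) (dvd_of_int_eq hab (x := m + 1) (z := Y + 1)
          (by push_cast at hma ⊢; linear_combination hma))
        omega
      rw [mod_eq_of_int (d := a + 2 * b - d) (Y := a - Y - 2) _ (by omega)]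
      · refine sideLetter_symp_right _ _ (by omega) (by omega) (by omega) fun h => ?_
        have h' : (2 * d : ℤ) = a + 2 * b := by exact_mod_cast h
        have := int_eq_of_dvd (dvd_of_int_eq hab (x := 2 * m + 1) (z := 2 * Y + 2)
          (by push_cast at hma ⊢; linear_combination 2 * hma + h')) (by omega) (by omega)
        omega
      · rw [hcast, Nat.cast_sub (by omega)]
        push_cast at hma ⊢
        linear_combination -hma

/-- The residue at the middle diagonal. -/
theorem two_mul_residue_even {a b m : ℕ} (hab : Nat.Coprime a b) (hm : 2 * m = a + b)
    (hc : 0 < a + b) : 2 * (m * a % (a + b)) = a + b := by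
  have hd := Nat.mod_lt (m * a) hc
  have hma : (m * a : ℤ) = (a + b : ℕ) * ((m * a / (a + b) : ℕ) : ℤ) + (m * a % (a + b) : ℕ) := by
    exact_mod_cast (Nat.div_add_mod (m * a) (a + b)).symm
  generalize m * a % (a + b) = d at *
  generalize ((m * a / (a + b) : ℕ) : ℤ) = Y at *
  have hm' : (2 * m : ℤ) = (a + b : ℕ) := by exact_mod_cast hm
  have key : (2 * d : ℤ) = (a + b : ℕ) * (a - 2 * Y) := by linear_combination a * hm' - 2 * hma
  have hc' : (0 : ℤ) < (a + b : ℕ) := by omega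
  have h0 : 0 ≤ (a : ℤ) - 2 * Y := by
    by_contra h
    nlinarith
  have h1 : (a : ℤ) - 2 * Y < 2 := by
    by_contra h
    have : (2 * d : ℤ) < 2 * (a + b : ℕ) := by omega
    nlinarith
  -- Otherwise `a` and `b` would both be even.
  have h2 : ¬ (a : ℤ) - 2 * Y = 0 := by
    intro h
    have : 2 ∣ Nat.gcd a b := Nat.dvd_gcd (by omega) (by omega)
    rw [hab] at this
    omega
  rw [show (a : ℤ) - 2 * Y = 1 by omega] at key
  omega

/-- The residue at the middle horizontal or vertical edge. -/
theorem two_mul_residue_odd {a b m : ℕ} (hm : 2 * m + 1 = a + b) (ha : 0 < a) :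
    2 * (m * a % (a + b)) = if a % 2 = 0 then a + 2 * b else b := by
  have hd := Nat.mod_lt (m * a) (show 0 < a + b by omega)
  have hma : (m * a : ℤ) = (a + b : ℕ) * ((m * a / (a + b) : ℕ) : ℤ) + (m * a % (a + b) : ℕ) := by
    exact_mod_cast (Nat.div_add_mod (m * a) (a + b)).symm
  generalize m * a % (a + b) = d at *
  generalize ((m * a / (a + b) : ℕ) : ℤ) = Y at *
  have hm' : (2 * m + 1 : ℤ) = (a + b : ℕ) := by exact_mod_cast hm
  have key : (2 * d + a : ℤ) = (a + b : ℕ) * (a - 2 * Y) := by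
    linear_combination a * hm' - 2 * hma
  have hc' : (0 : ℤ) < (a + b : ℕ) := by omega
  have h0 : 0 < (a : ℤ) - 2 * Y := by
    by_contra h
    nlinarith
  have h1 : (a : ℤ) - 2 * Y < 3 := by
    by_contra h
    have : (2 * d + a : ℤ) < 3 * (a + b : ℕ) := by omega
    nlinarith
  split_ifs with hpar
  · rw [show (a : ℤ) - 2 * Y = 2 by omega] at key
    omega
  · rw [show (a : ℤ) - 2 * Y = 1 by omega] at key
    omega

/-! ### Comparison of the letters of a fraction with those of a mediant -/

/-- The signs can disagree only when `A = 1` and `S = 0`, that is `w = c`. Below, `A` and `S` are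
the distances to a threshold for a fraction and for the mediant, and `w = c` singles out the middle
letter. -/
theorem pos_iff_pos_of_affine {c c' A S w : ℤ} (hc' : 0 < c') (hcc : c' < c)
    (h : c * A = c' * S + w) (hw : 0 ≤ w) (hw' : w ≤ 2 * c') (hne : w ≠ c) : 0 < A ↔ 0 < S := by
  constructor
  · intro hA
    by_contra hS
    have hA1 : A < 2 := by nlinarith
    obtain rfl : A = 1 := by omega
    rcases (not_lt.1 hS).eq_or_lt with rfl | hS'
    · exact hne (by linarith)
    · nlinarith
  · intro hS
    by_contra hA
    nlinarith

theorem diagLetter_eq {x y x' y' d g : ℕ} {v : ℤ}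
    (hc' : 0 < x' + y') (hcc : x' + y' < x + y)
    (hg : ((x' + y' : ℕ) * g : ℤ) = (x + y : ℕ) * d + v)
    (hv : 0 ≤ v) (hv' : v ≤ (x' + y' : ℕ))
    (hne : 2 * v ≠ (x + y : ℕ)) :
    diagLetter kD x' y' d = diagLetter kD x y g := by
  have h := pos_iff_pos_of_affine (c := (x + y : ℕ)) (c' := (x' + y' : ℕ))
    (A := (x' + y' : ℕ) - 2 * d) (S := (x + y : ℕ) - 2 * g) (w := 2 * v) (by omega) (by omega)
    (by linear_combination 2 * hg) (by omega) (by omega) hne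
  have : 2 * d < x' + y' ↔ 2 * g < x + y := by omega
  simp only [diagLetter, this]

theorem diagLetter_sub {x y x' y' d g : ℕ} {v : ℤ}
    (hcc : x' + y' < x + y)
    (hg : ((x' + y' : ℕ) * g : ℤ) = (x + y : ℕ) * d + v)
    (hmid : 2 * v = (x + y : ℕ)) (htie : 2 * g = x + y) :
    diagLetter kD x' y' d - diagLetter kD x y g = (kD : ℤ) • sympMat := by
  have htie' : (2 * g : ℤ) = (x + y : ℕ) := by exact_mod_cast htie
  have h : ((x + y : ℕ) : ℤ) * ((x' + y' : ℕ) - 2 * d - 1) = 0 := by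
    linear_combination 2 * hg - (x' + y' : ℕ) * htie' + hmid
  -- Here `2 * d` falls one short of its threshold while `2 * g` attains its own: minus signs
  -- against plus signs.
  have h' := (mul_eq_zero.1 h).resolve_left (by omega)
  rw [diagLetter, diagLetter, if_pos (by omega), if_neg (by omega), upMat_sub_loMat]

/-- The choice between vertical and horizontal edge has no exceptional position: `v + s` is at most
`x' + y'`, hence below `x + y`. -/
theorem lt_iff_lt_of_compare {x y x' y' d g : ℕ} {v s : ℤ}
    (hc' : 0 < x' + y') (hcc : x' + y' < x + y)
    (hg : ((x' + y' : ℕ) * g : ℤ) = (x + y : ℕ) * d + v)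
    (hs : ((x + y : ℕ) * y' : ℤ) = (x' + y' : ℕ) * y + s)
    (hvs : 0 ≤ v + s) (hvs' : v + s ≤ (x' + y' : ℕ)) : d < y' ↔ g < y := by
  have h := pos_iff_pos_of_affine (c := (x + y : ℕ)) (c' := (x' + y' : ℕ))
    (A := y' - d) (S := y - g) (w := v + s) (by omega) (by omega)
    (by linear_combination hg + hs) (by omega) (by omega) (by omega)
  omega

theorem sideLetter_eq {x y x' y' d g : ℕ} {v s : ℤ}
    (hc' : 0 < x' + y') (hcc : x' + y' < x + y)
    (hg : ((x' + y' : ℕ) * g : ℤ) = (x + y : ℕ) * d + v)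
    (hv : 0 ≤ v) (hv' : v ≤ (x' + y' : ℕ))
    (hs : ((x + y : ℕ) * y' : ℤ) = (x' + y' : ℕ) * y + s) (hvs : 0 ≤ v + s) (hvs' : v + s ≤ (x' + y' : ℕ))
    (hne : 2 * v + s ≠ (x + y : ℕ)) :
    sideLetter kH kV x' y' d = sideLetter kH kV x y g := by
  have h0 := lt_iff_lt_of_compare hc' hcc hg hs hvs hvs'
  have h1 := pos_iff_pos_of_affine (c := (x + y : ℕ)) (c' := (x' + y' : ℕ))
    (A := y' - 2 * d) (S := y - 2 * g) (w := 2 * v + s) (by omega) (by omega)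
    (by linear_combination 2 * hg + hs) (by omega) (by omega) hne
  have h2 := pos_iff_pos_of_affine (c := (x + y : ℕ)) (c' := (x' + y' : ℕ))
    (A := (x' + y' : ℕ) + y' - 2 * d) (S := (x + y : ℕ) + y - 2 * g) (w := 2 * v + s)
    (by omega) (by omega) (by linear_combination 2 * hg + hs) (by omega) (by omega) hne
  have h1' : 2 * d < y' ↔ 2 * g < y := by omega
  have h2' : 2 * d < x' + 2 * y' ↔ 2 * g < x + 2 * y := by omega
  simp only [sideLetter, h0, h1', h2']

theorem sideLetter_sub {x y x' y' d g : ℕ} {v s : ℤ}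
    (hc' : 0 < x' + y') (hcc : x' + y' < x + y)
    (hg : ((x' + y' : ℕ) * g : ℤ) = (x + y : ℕ) * d + v)
    (hs : ((x + y : ℕ) * y' : ℤ) = (x' + y' : ℕ) * y + s)
    (hvs : 0 ≤ v + s) (hvs' : v + s ≤ (x' + y' : ℕ))
    (hmid : 2 * v + s = (x + y : ℕ)) (hx : 0 < x)
    (htie : 2 * g = if x % 2 = 0 then x + 2 * y else y) :
    sideLetter kH kV x' y' d - sideLetter kH kV x y g =
      ((if x % 2 = 0 then kH else kV : ℕ) : ℤ) • sympMat := by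
  have h0 := lt_iff_lt_of_compare hc' hcc hg hs hvs hvs'
  split_ifs at htie ⊢ with hpar
  · have htie' : (2 * g : ℤ) = (x + y : ℕ) + y := by omega
    have h : ((x + y : ℕ) : ℤ) * ((x' + y' : ℕ) + y' - 2 * d - 1) = 0 := by
      linear_combination 2 * hg + hs - (x' + y' : ℕ) * htie' + hmid
    have h' := (mul_eq_zero.1 h).resolve_left (by omega)
    have e1 : ¬ d < y' := by omega
    have e2 : ¬ g < y := by omega
    have e3 : 2 * d < x' + 2 * y' := by omega
    have e4 : ¬ 2 * g < x + 2 * y := by omega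
    rw [sideLetter, sideLetter, if_neg e1, if_neg e2, if_pos e3, if_neg e4, ← sub_mul, ← mul_sub, upMat_sub_loMat, mul_smul_comm, smul_mul_assoc,
      loMat_symp_upMat]
  · have htie' : (2 * g : ℤ) = y := by exact_mod_cast htie
    have h : ((x + y : ℕ) : ℤ) * (y' - 2 * d - 1) = 0 := by
      linear_combination 2 * hg + hs - (x' + y' : ℕ) * htie' + hmid
    have h' := (mul_eq_zero.1 h).resolve_left (by omega)
    have e1 : d < y' := by omega
    have e2 : g < y := by omega
    have e3 : 2 * d < y' := by omega
    have e4 : ¬ 2 * g < y := by omega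
    rw [sideLetter, sideLetter, if_pos e1, if_pos e2, if_pos e3, if_neg e4, ← sub_mul, ← mul_sub, upMat_sub_loMat, mul_smul_comm, smul_mul_assoc,
      upMat_symp_loMat]

end Letters

/-! ### The recursion for letter products at a mediant -/

section Recursion

variable (kH kD kV : ℕ) {a b a' b' : ℕ}

theorem left_residue (h : a' * b = a * b' + 1) {m : ℕ} (hm : m < a + b) :
    ((a + b : ℕ) * (m * (a + a') % (a + a' + (b + b')) : ℕ) : ℤ) =
      (a + a' + (b + b') : ℕ) * (m * a % (a + b) : ℕ) + m := by
  have hd := Nat.mod_lt (m * a) (show 0 < a + b by omega)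
  have hma : (m * a : ℤ) = (a + b : ℕ) * ((m * a / (a + b) : ℕ) : ℤ) + (m * a % (a + b) : ℕ) := by
    exact_mod_cast (Nat.div_add_mod (m * a) (a + b)).symm
  have hdet : (a' * b : ℤ) = a * b' + 1 := by exact_mod_cast h
  generalize m * a % (a + b) = d at *
  generalize ((m * a / (a + b) : ℕ) : ℤ) = Y at *
  -- The quotient `Y` stays the same for the mediant; `e` is what `a'` and `b'` add to the residue.
  obtain ⟨e, he⟩ : ∃ e : ℤ, e = m * a' - (a' + b' : ℕ) * Y := ⟨_, rfl⟩
  have key : ((a + b : ℕ) : ℤ) * e = m + (a' + b' : ℕ) * d := by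
    rw [he]
    push_cast at hma ⊢
    linear_combination m * hdet + (a' + b') * hma
  have hc : (0 : ℤ) < (a + b : ℕ) := by omega
  have hc' : (0 : ℤ) ≤ (a' + b' : ℕ) := by omega
  have he0 : 0 ≤ e := by
    by_contra hneg
    have : (0 : ℤ) ≤ (a' + b' : ℕ) * d := by positivity
    nlinarith
  have hsum : (d : ℤ) + e < (a + a' + (b + b') : ℕ) := by
    by_contra hge
    have h1 : (1 : ℤ) ≤ (a + b : ℕ) - d := by omega
    have h2 : (a' + b' : ℕ) - e ≤ -(((a + b : ℕ) : ℤ) - d) := by push_cast at hge ⊢; linarith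
    have hmc : (m : ℤ) < (a + b : ℕ) := by exact_mod_cast hm
    nlinarith [mul_le_mul_of_nonneg_left h2 hc.le, mul_le_mul_of_nonneg_left h1 hc.le,
      mul_nonneg hc' (zero_le_one.trans h1)]
  lift e to ℕ using he0
  rw [mod_eq_of_int (d := d + e) (Y := Y) _ (by omega)]
  · push_cast at key ⊢
    linear_combination key
  · push_cast at hma he ⊢
    linear_combination hma - he

theorem right_residue (h : a' * b = a * b' + 1) {m : ℕ} (hm : m < a' + b') :
    ((a' + b' : ℕ) * ((a + b + m) * (a + a') % (a + a' + (b + b')) : ℕ) : ℤ) =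
      (a + a' + (b + b') : ℕ) * (m * a' % (a' + b') : ℕ) + ((a' + b' : ℕ) - m) := by
  have hd := Nat.mod_lt (m * a') (show 0 < a' + b' by omega)
  have hma : (m * a' : ℤ) =
      (a' + b' : ℕ) * ((m * a' / (a' + b') : ℕ) : ℤ) + (m * a' % (a' + b') : ℕ) := by
    exact_mod_cast (Nat.div_add_mod (m * a') (a' + b')).symm
  have hdet : (a' * b : ℤ) = a * b' + 1 := by exact_mod_cast h
  generalize m * a' % (a' + b') = d at *
  generalize ((m * a' / (a' + b') : ℕ) : ℤ) = Y at *
  -- By the determinant identity, the `a + b` preceding squares add `a` to the quotient and 1 to the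
  -- residue, so the mediant has residue `1 + d + e`.
  obtain ⟨e, he⟩ : ∃ e : ℤ, e = m * a - (a + b : ℕ) * Y := ⟨_, rfl⟩
  have key : ((a + b : ℕ) : ℤ) * d = m + (a' + b' : ℕ) * e := by
    rw [he]
    push_cast at hma ⊢
    linear_combination m * hdet - (a + b) * hma
  have hc : (0 : ℤ) < (a' + b' : ℕ) := by omega
  have hc' : (0 : ℤ) < (a + b : ℕ) := by
    rcases Nat.eq_zero_or_pos b with rfl | hb
    · simp at h
    · omega
  have he0 : 0 ≤ e := by
    by_contra hneg
    have : (0 : ℤ) ≤ (a + b : ℕ) * d := by positivity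
    have hmc : (m : ℤ) < (a' + b' : ℕ) := by exact_mod_cast hm
    nlinarith [mul_le_mul_of_nonneg_left (show e ≤ -1 by omega) hc.le]
  have hsum : (1 : ℤ) + d + e < (a + a' + (b + b') : ℕ) := by
    have h1 : (1 : ℤ) ≤ (a' + b' : ℕ) - d := by omega
    have h2 : (1 : ℤ) ≤ (a + b : ℕ) - e := by
      by_contra hge
      nlinarith
    push_cast at h1 h2 ⊢
    linarith
  lift e to ℕ using he0
  rw [mod_eq_of_int (d := 1 + d + e) (Y := a + Y) _ (by omega)]
  · push_cast at key ⊢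
    linear_combination -key
  · push_cast at hma he ⊢
    linear_combination hma - he + hdet

/-- The concatenation of the letters of two fractions. -/
def concatLetter (a b a' b' n : ℕ) : Matrix (Fin 2) (Fin 2) ℤ :=
  if n < 2 * (a + b) then letter kH kD kV a b n else letter kH kD kV a' b' (n - 2 * (a + b))

theorem concatLetter_left {n : ℕ} (h : n < 2 * (a + b)) :
    concatLetter kH kD kV a b a' b' n = letter kH kD kV a b n := if_pos h

theorem concatLetter_right (n : ℕ) :
    concatLetter kH kD kV a b a' b' (2 * (a + b) + n) = letter kH kD kV a' b' n := by
  rw [concatLetter, if_neg (by omega), Nat.add_sub_cancel_left]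

theorem letterProd_mul_letterProd :
    letterProd kH kD kV a b * letterProd kH kD kV a' b' =
      seqProd (concatLetter kH kD kV a b a' b') (2 * (a + a' + (b + b'))) := by
  rw [show 2 * (a + a' + (b + b')) = 2 * (a + b) + 2 * (a' + b') by ring, seqProd_add]
  simp only [concatLetter_right]
  rw [seqProd_congr (g := letter kH kD kV a b) fun i hi => concatLetter_left kH kD kV hi]
  rfl

/-- In the threshold comparisons `w` is `n` on the left part and `2 * (x + y) - n` on the right
part, with `x / y` the mediant. Either way `w = x + y` only at the middle. -/
theorem concatLetter_eq (h : a' * b = a * b' + 1) {n : ℕ} (hn : n < 2 * (a + a' + (b + b')))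
    (hne : n ≠ a + a' + (b + b')) :
    concatLetter kH kD kV a b a' b' n = letter kH kD kV (a + a') (b + b') n := by
  have hdet : (a' * b : ℤ) = a * b' + 1 := by exact_mod_cast h
  have hb : 0 < b := Nat.pos_of_ne_zero (by rintro rfl; simp at h)
  have ha' : 0 < a' := Nat.pos_of_ne_zero (by rintro rfl; simp at h)
  by_cases hlt : n < 2 * (a + b)
  · rw [concatLetter_left _ _ _ hlt]
    obtain ⟨m, rfl | rfl⟩ := Nat.even_or_odd' n
    · rw [letter_even, letter_even]
      exact diagLetter_eq _ (by omega) (by omega) (left_residue h (by omega)) (by omega)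
        (by omega) (by omega)
    · rw [letter_odd, letter_odd]
      exact sideLetter_eq (s := 1) _ _ (by omega) (by omega) (left_residue h (by omega)) (by omega)
        (by omega) (by push_cast; linear_combination hdet) (by omega) (by omega) (by omega)
  · obtain ⟨n, rfl⟩ := Nat.exists_eq_add_of_le (not_lt.1 hlt)
    rw [concatLetter_right]
    obtain ⟨m, rfl | rfl⟩ := Nat.even_or_odd' n
    · rw [← mul_add, letter_even, letter_even]
      exact diagLetter_eq _ (by omega) (by omega) (right_residue h (by omega)) (by omega)
        (by omega) (by omega)
    · rw [← add_assoc, ← mul_add, letter_odd, letter_odd]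
      exact sideLetter_eq (s := -1) _ _ (by omega) (by omega) (right_residue h (by omega))
        (by omega) (by omega) (by push_cast; linear_combination -hdet) (by omega) (by omega)
        (by omega)

theorem coprime_mediant (h : a' * b = a * b' + 1) : Nat.Coprime (a + a') (b + b') := by
  have h1 : Nat.gcd (a + a') (b + b') ∣ (a + a') * b := (Nat.gcd_dvd_left _ _).mul_right _
  have h2 : Nat.gcd (a + a') (b + b') ∣ a * (b + b') := (Nat.gcd_dvd_right _ _).mul_left _
  have h3 : (a + a') * b = a * (b + b') + 1 := by linear_combination h
  rw [h3] at h1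
  exact Nat.dvd_one.1 ((Nat.dvd_add_right h2).1 h1)

/-- The middle letter is diagonal when numerator and denominator of the mediant are both odd;
otherwise it is horizontal or vertical according to which of them is even. -/
theorem concatLetter_sub_mid (h : a' * b = a * b' + 1) :
    concatLetter kH kD kV a b a' b' (a + a' + (b + b')) -
      letter kH kD kV (a + a') (b + b') (a + a' + (b + b')) =
      ((parityVal kH kD kV (a + a', b + b') : ℕ) : ℤ) • sympMat := by
  have hdet : (a' * b : ℤ) = a * b' + 1 := by exact_mod_cast h
  have hb : 0 < b := Nat.pos_of_ne_zero (by rintro rfl; simp at h)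
  have ha' : 0 < a' := Nat.pos_of_ne_zero (by rintro rfl; simp at h)
  have hcop := coprime_mediant h
  obtain ⟨m, hm⟩ := Nat.even_or_odd' (a + a' + (b + b'))
  rcases hm with hm | hm
  · have hpar : parityVal kH kD kV (a + a', b + b') = kD := by
      have hodd : ¬ (a + a') % 2 = 0 := fun h0 => by
        have : 2 ∣ Nat.gcd (a + a') (b + b') := Nat.dvd_gcd (by omega) (by omega)
        rw [hcop] at this
        omega
      rw [parityVal, if_neg hodd, if_neg (by dsimp only; omega)]
    have htie := two_mul_residue_even hcop hm.symm (by omega)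
    rw [hpar]
    by_cases hlt : a + a' + (b + b') < 2 * (a + b)
    · rw [concatLetter_left _ _ _ hlt]
      conv_lhs => rw [hm, letter_even, letter_even]
      exact diagLetter_sub _ (by omega) (left_residue h (by omega)) (by omega) htie
    · obtain ⟨n, rfl⟩ := Nat.exists_eq_add_of_le (show a + b ≤ m by omega)
      conv_lhs => rw [hm, letter_even, mul_add, concatLetter_right, letter_even]
      exact diagLetter_sub _ (by omega) (right_residue h (by omega)) (by omega) htie
  · have hpar : parityVal kH kD kV (a + a', b + b') = if (a + a') % 2 = 0 then kH else kV := by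
      rw [parityVal]
      split_ifs
      · rfl
      · rfl
      · dsimp only at *
        omega
    have htie := two_mul_residue_odd hm.symm (by omega)
    rw [hpar]
    by_cases hlt : a + a' + (b + b') < 2 * (a + b)
    · rw [concatLetter_left _ _ _ hlt]
      conv_lhs => rw [hm, letter_odd, letter_odd]
      exact sideLetter_sub (s := 1) _ _ (by omega) (by omega) (left_residue h (by omega))
        (by push_cast; linear_combination hdet) (by omega) (by omega) (by omega) (by omega) htie
    · obtain ⟨n, rfl⟩ := Nat.exists_eq_add_of_le (show a + b ≤ m by omega)
      conv_lhs => rw [hm, letter_odd, mul_add, add_assoc, concatLetter_right, letter_odd]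
      exact sideLetter_sub (s := -1) _ _ (by omega) (by omega) (right_residue h (by omega))
        (by push_cast; linear_combination -hdet) (by omega) (by omega) (by omega) (by omega) htie

/-- The recursion that defines the generalized Cohn matrices. -/
theorem letterProd_mediant (h : a' * b = a * b' + 1) :
    letterProd kH kD kV (a + a') (b + b') = letterProd kH kD kV a b * letterProd kH kD kV a' b' -
      ((parityVal kH kD kV (a + a', b + b') : ℕ) : ℤ) • upMat (3 + kH + kD + kV) := by
  have hb : 0 < b := Nat.pos_of_ne_zero (by rintro rfl; simp at h)
  have ha' : 0 < a' := Nat.pos_of_ne_zero (by rintro rfl; simp at h)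
  have hcop := coprime_mediant h
  have hmid := concatLetter_sub_mid kH kD kV h
  have heq := fun n => concatLetter_eq kH kD kV h (n := n)
  rw [letterProd_mul_letterProd]
  generalize ((parityVal kH kD kV (a + a', b + b') : ℕ) : ℤ) = kk at *
  generalize concatLetter kH kD kV a b a' b' = f at *
  have hx : 0 < a + a' := by omega
  have hy : 0 < b + b' := by omega
  unfold letterProd
  generalize a + a' = x at *
  generalize b + b' = y at *
  clear h
  -- `N` letters on each side of the middle cancel in pairs; letters 0, 1 and the last one remain.
  obtain ⟨N, hN⟩ := Nat.exists_eq_add_of_le (show 2 ≤ x + y by omega)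
  have split : ∀ u : ℕ → Matrix (Fin 2) (Fin 2) ℤ, seqProd u (2 * (x + y)) =
      (u 0 * u 1 * seqProd (fun i => u (2 + i)) N) * u (x + y) *
        (seqProd (fun i => u (x + y + 1 + i)) N * u (2 * (x + y) - 1)) := fun u => by
    rw [show 2 * (x + y) = (2 + N) + 1 + N + 1 by omega, seqProd, seqProd_add, seqProd, seqProd_add]
    rw [show x + y + 1 = 2 + N + 1 by omega, show x + y = 2 + N by omega]
    simp [seqProd, mul_assoc]
  -- All factors except the middle one agree, so the difference of the products factors through the
  -- difference of the middle letters.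
  rw [split f, split (letter kH kD kV x y), heq 0 (by omega) (by omega),
    heq 1 (by omega) (by omega), heq (2 * (x + y) - 1) (by omega) (by omega),
    seqProd_congr (g := fun i => letter kH kD kV x y (2 + i))
      fun i hi => heq _ (by omega) (by omega),
    seqProd_congr (f := fun i => f (x + y + 1 + i))
      (g := fun i => letter kH kD kV x y (x + y + 1 + i))
      fun i hi => heq _ (by omega) (by omega),
    eq_sub_iff_add_eq, ← eq_sub_iff_add_eq', ← sub_mul, ← mul_sub, hmid]
  have hcancel : seqProd (fun i => letter kH kD kV x y (2 + i)) N * sympMat *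
      seqProd (fun i => letter kH kD kV x y (x + y + 1 + i)) N = sympMat := by
    refine seqProd_mul_mul_seqProd fun i hi => ?_
    have := letter_symp_letter kH kD kV hcop (n := 2 + i) (by omega) (by omega) (by omega)
    rwa [show 2 * (x + y) - (2 + i) = x + y + 1 + (N - 1 - i) by omega] at this
  have h0 : letter kH kD kV x y 0 = upMat kD := by
    simp [letter, diagLetter]
    omega
  have h1 : letter kH kD kV x y 1 = upMat (1 + kV) * loMat 1 := by
    simp [letter, sideLetter, hy, upMat_mul]
  have hlast : letter kH kD kV x y (2 * (x + y) - 1) = loMat 1 * upMat (kH + 1) := by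
    rw [show 2 * (x + y) - 1 = 2 * (x + y - 1) + 1 by omega, letter_odd,
      mod_eq_of_int (d := y) (Y := x - 1) _ (by omega), sideLetter, if_neg (lt_irrefl _),
      if_pos (by omega), mul_assoc, upMat_mul]
    rw [Nat.cast_sub (by omega)]
    push_cast
    ring
  rw [h0, h1, hlast]
  -- The two L left next to J give L J L = U, so the exponents of U add up to `kD + (1 + kV) + 1 +
  -- (kH + 1)`.
  calc kk • upMat (3 + kH + kD + kV)
      = kk • (upMat kD * upMat (1 + kV) * (loMat 1 * sympMat * loMat 1) * upMat (kH + 1)) := by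
        rw [loMat_symp_loMat, upMat_mul, upMat_mul, upMat_mul]
        congr 2
        ring
    _ = kk • (upMat kD * (upMat (1 + kV) * loMat 1) *
          (seqProd (fun i => letter kH kD kV x y (2 + i)) N * sympMat *
            seqProd (fun i => letter kH kD kV x y (x + y + 1 + i)) N) * (loMat 1 * upMat (kH + 1))) := by
        rw [hcancel]
        simp only [mul_assoc]
    _ = _ := by
        simp only [mul_smul_comm, smul_mul_assoc, mul_assoc]

end Recursion

/-! ### Closed form of the Cohn matrices along the tree -/

section Tree

variable (k : Fin 3 → ℕ) (σ : Equiv.Perm (Fin 3))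

/-- The closed form of the generalized Cohn matrix of the fraction `q.1 / q.2`. -/
def closedCohn (q : ℕ × ℕ) : Matrix (Fin 2) (Fin 2) ℤ :=
  upMat (1 + k (σ 0)) * letterProd (k (σ 0)) (k (σ 1)) (k (σ 2)) q.1 q.2 * upMat (-(1 + k (σ 0)))

theorem kConst_eq : kConst k = 3 + k (σ 0) + k (σ 1) + k (σ 2) := by
  have h := Equiv.sum_comp σ fun i => (k i : ℤ)
  simp only [Fin.sum_univ_three] at h
  simp only [kConst]
  linarith

theorem dMatrix_eq (i : Fin 3) : dMatrix k i = (k i : ℤ) • upMat (kConst k) := by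
  ext x y
  fin_cases x <;> fin_cases y <;> simp [dMatrix, upMat]

theorem apply_parityVal (q : ℕ × ℕ) :
    k (parityVal (σ 0) (σ 1) (σ 2) q) = parityVal (k (σ 0)) (k (σ 1)) (k (σ 2)) q := by
  unfold parityVal
  split_ifs <;> rfl

/-- The inner conjugating factors cancel, and the correction term commutes with the outer ones, all
being upper unipotent up to a scalar. -/
theorem closedCohn_mediant {q r : ℕ × ℕ} (h : r.1 * q.2 = q.1 * r.2 + 1) :
    closedCohn k σ (mediant q r) = closedCohn k σ q * closedCohn k σ r -
      dMatrix k (parityVal (σ 0) (σ 1) (σ 2) (mediant q r)) := by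
  have hinv : upMat (-(1 + k (σ 0))) * upMat (1 + k (σ 0)) = 1 := by
    rw [upMat_mul, neg_add_cancel, upMat_zero]
  rw [dMatrix_eq, apply_parityVal k σ, kConst_eq k σ]
  unfold closedCohn
  rw [show letterProd (k (σ 0)) (k (σ 1)) (k (σ 2)) (mediant q r).1 (mediant q r).2 = _ from
    letterProd_mediant _ _ _ h]
  rw [mul_sub, sub_mul, mul_smul_comm, smul_mul_assoc, upMat_mul, upMat_mul]
  congr 1
  · symm
    calc _ = upMat (1 + k (σ 0)) * letterProd (k (σ 0)) (k (σ 1)) (k (σ 2)) q.1 q.2 *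
          (upMat (-(1 + k (σ 0))) * upMat (1 + k (σ 0))) *
          letterProd (k (σ 0)) (k (σ 1)) (k (σ 2)) r.1 r.2 * upMat (-(1 + k (σ 0))) := by
          simp only [mul_assoc]
      _ = _ := by rw [hinv, mul_one]; simp only [mul_assoc]
  · congr 2
    ring

theorem parityVal_mediant_right {α : Type*} (x y z : α) (q r : ℕ × ℕ) :
    parityVal x y z (mediant (mediant q r) r) = parityVal x y z q := by
  have h1 : (q.1 + r.1 + r.1) % 2 = q.1 % 2 := by omega
  have h2 : (q.2 + r.2 + r.2) % 2 = q.2 % 2 := by omega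
  simp only [parityVal, mediant, h1, h2]

theorem parityVal_mediant_left {α : Type*} (x y z : α) (q r : ℕ × ℕ) :
    parityVal x y z (mediant q (mediant q r)) = parityVal x y z r := by
  have h1 : (q.1 + (q.1 + r.1)) % 2 = r.1 % 2 := by omega
  have h2 : (q.2 + (q.2 + r.2)) % 2 = r.2 % 2 := by omega
  simp only [parityVal, mediant, h1, h2]

theorem fareyTree_spec (p : List Bool) :
    (fareyTree p).2.1 = mediant (fareyTree p).1 (fareyTree p).2.2 ∧
      (fareyTree p).2.2.1 * (fareyTree p).1.2 = (fareyTree p).1.1 * (fareyTree p).2.2.2 + 1 := by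
  induction p with
  | nil => simp [fareyTree, mediant]
  | cons x p ih =>
    obtain ⟨h1, h2⟩ := ih
    cases x <;> simp only [fareyTree, true_and] <;> rw [h1] <;> simp only [mediant] <;>
      linarith

/-- Modulo 2 the new mediant is congruent to the fraction dropped from the triple, since the
fraction kept beside the old middle is added twice; the Markov tree likewise hands the dropped
position to the new number. -/
theorem gmTree_position (p : List Bool) :
    (gmTree k σ p).1.2 = parityVal (σ 0) (σ 1) (σ 2) (fareyTree p).1 ∧
      (gmTree k σ p).2.1.2 = parityVal (σ 0) (σ 1) (σ 2) (fareyTree p).2.1 ∧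
      (gmTree k σ p).2.2.2 = parityVal (σ 0) (σ 1) (σ 2) (fareyTree p).2.2 := by
  induction p with
  | nil => simp [gmTree, fareyTree, parityVal]
  | cons x p ih =>
    obtain ⟨h1, h2, h3⟩ := ih
    have hm := (fareyTree_spec p).1
    cases x
    · refine ⟨h2, ?_, h3⟩
      simp only [fareyTree]
      rw [hm, parityVal_mediant_right]
      exact h1
    · refine ⟨h1, ?_, h2⟩
      simp only [fareyTree]
      rw [hm, parityVal_mediant_left]
      exact h3

theorem cohnTree_eq (p : List Bool) :
    (cohnTree k σ p).1 = closedCohn k σ (fareyTree p).1 ∧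
      (cohnTree k σ p).2.1 = closedCohn k σ (fareyTree p).2.1 ∧
      (cohnTree k σ p).2.2 = closedCohn k σ (fareyTree p).2.2 := by
  induction p with
  | nil =>
    refine ⟨?_, ?_, ?_⟩ <;>
      simp [cohnTree, fareyTree, closedCohn, letterProd, seqProd, letter, diagLetter, sideLetter,
        upMat, loMat, kConst_eq k σ] <;> ring_nf <;> simp
  | cons x p ih =>
    obtain ⟨h1, h2, h3⟩ := ih
    obtain ⟨hm, hd⟩ := fareyTree_spec p
    obtain ⟨g1, -, g3⟩ := gmTree_position k σ p
    cases x
    · refine ⟨h2, ?_, h3⟩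
      simp only [cohnTree, fareyTree]
      rw [closedCohn_mediant, h2, h3, g1]
      · rw [hm, parityVal_mediant_right]
      · rw [hm]; simp only [mediant]; linarith
    · refine ⟨h1, ?_, h2⟩
      simp only [cohnTree, fareyTree]
      rw [closedCohn_mediant, h1, h2, g3]
      · rw [hm, parityVal_mediant_left]
      · rw [hm]; simp only [mediant]; linarith

theorem isCohnMatrix_eq {q : ℕ × ℕ} {M : Matrix (Fin 2) (Fin 2) ℤ} (h : IsCohnMatrix k σ q M) :
    M = closedCohn k σ q := by
  obtain ⟨p, ⟨rfl, rfl⟩ | ⟨rfl, rfl⟩ | ⟨rfl, rfl⟩⟩ := h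
  exacts [(cohnTree_eq k σ p).1, (cohnTree_eq k σ p).2.1, (cohnTree_eq k σ p).2.2]

/-- Subtractive Euclidean algorithm on the weights `x`, `y` of the outer fractions; `n` only bounds
the induction. -/
theorem exists_fareyTree (n : ℕ) : ∀ (p : List Bool) (x y : ℕ), x + y ≤ n → 0 < x → 0 < y →
    Nat.Coprime x y → ∃ p', (fareyTree p').2.1 =
      (x * (fareyTree p).1.1 + y * (fareyTree p).2.2.1,
        x * (fareyTree p).1.2 + y * (fareyTree p).2.2.2) := by
  induction n with
  | zero => intros; omega
  | succ n ih =>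
    intro p x y hn hx hy hxy
    have hm := (fareyTree_spec p).1
    rcases lt_trichotomy x y with h | rfl | h
    · obtain ⟨z, rfl⟩ := Nat.exists_eq_add_of_le h.le
      obtain ⟨p', hp'⟩ := ih (false :: p) x z (by omega) hx (by omega) (by simpa using hxy)
      refine ⟨p', hp'.trans ?_⟩
      simp only [fareyTree, hm, mediant]
      ext <;> simp <;> ring
    · obtain rfl : x = 1 := by simpa using hxy
      exact ⟨p, by simp [hm, mediant]⟩
    · obtain ⟨z, rfl⟩ := Nat.exists_eq_add_of_le h.le
      obtain ⟨p', hp'⟩ := ih (true :: p) z y (by omega) (by omega) hy (by simpa using hxy)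
      refine ⟨p', hp'.trans ?_⟩
      simp only [fareyTree, hm, mediant]
      ext <;> simp <;> ring

theorem existsUnique_isCohnMatrix {a b : ℕ} (ha : 0 < a) (hab : Nat.Coprime a b) :
    ∃! M, IsCohnMatrix k σ (a, b) M := by
  refine existsUnique_of_exists_of_unique ?_ fun M N hM hN =>
    (isCohnMatrix_eq k σ hM).trans (isCohnMatrix_eq k σ hN).symm
  rcases Nat.eq_zero_or_pos b with rfl | hb
  · obtain rfl : a = 1 := by simpa using hab
    exact ⟨_, [], Or.inr (Or.inr ⟨rfl, rfl⟩)⟩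
  · obtain ⟨p, hp⟩ := exists_fareyTree (b + a) [] b a le_rfl hb ha hab.symm
    exact ⟨_, p, Or.inr (Or.inl ⟨by simpa [fareyTree] using hp, rfl⟩)⟩

end Tree

/-! ### The squares crossed by the segment -/

/-- The lower left corner of the `m`-th square that the segment crosses. -/
def squareCorner (a b m : ℕ) : ℤ × ℤ := (m - 1 - (m * a / (a + b) : ℕ), (m * a / (a + b) : ℕ))

/-- The cells of the `m`-th square through which the segment passes. -/
def squareCells (a b m : ℕ) : List Cell :=
  [if m * a % (a + b) < a then .horizontal (squareCorner a b m).1 (squareCorner a b m).2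
    else .vertical (squareCorner a b m).1 (squareCorner a b m).2,
    .lowerTriangle (squareCorner a b m).1 (squareCorner a b m).2,
    .diagonal (squareCorner a b m).1 (squareCorner a b m).2,
    .upperTriangle (squareCorner a b m).1 (squareCorner a b m).2]

/-- The cells through which the segment passes, in their order. -/
def itinerary (a b : ℕ) : List Cell := (List.range (a + b)).flatMap (squareCells a b)

/-- The lower left corner of the grid square that contains a cell. -/
def Cell.corner : Cell → ℤ × ℤ
  | .horizontal x y => (x, y)
  | .diagonal x y => (x, y)
  | .vertical x y => (x, y)
  | .lowerTriangle x y => (x, y)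
  | .upperTriangle x y => (x, y)

theorem Cell.bounds_of_mem {c : Cell} {P : ℝ × ℝ} (h : P ∈ c.points) :
    (c.corner.1 : ℝ) ≤ P.1 ∧ P.1 < c.corner.1 + 1 ∧ (c.corner.2 : ℝ) ≤ P.2 ∧
      P.2 < c.corner.2 + 1 := by
  cases c <;> simp only [Cell.points, Set.mem_ofPred_eq, Cell.corner] at h ⊢ <;>
    obtain ⟨h1, h2, h3⟩ := h <;> refine ⟨?_, ?_, ?_, ?_⟩ <;> linarith

theorem corner_eq_of_mem_squareCells {a b m : ℕ} {c : Cell} (h : c ∈ squareCells a b m) :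
    c.corner = squareCorner a b m := by
  simp only [squareCells, List.mem_cons, List.not_mem_nil, or_false] at h
  rcases h with rfl | rfl | rfl | rfl
  · split_ifs <;> rfl
  all_goals rfl

/-- Thus `side` at the lower right corner of the square is minus the residue, minus `a * ε`. -/
theorem residue_eq (a b m : ℕ) : ((m * a % (a + b) : ℕ) : ℤ) =
    a * ((squareCorner a b m).1 + 1) - b * (squareCorner a b m).2 := by
  have h : ((m * a : ℕ) : ℤ) = (((a + b) * (m * a / (a + b)) + m * a % (a + b) : ℕ) : ℤ) := by
    rw [Nat.div_add_mod]
  simp only [squareCorner]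
  push_cast at h ⊢
  linear_combination -h

theorem residue_lt {a b : ℕ} (ha : 0 < a) (m : ℕ) : m * a % (a + b) < a + b :=
  Nat.mod_lt _ (by omega)

theorem squareCorner_bounds {a b m : ℕ} (ha : 0 < a) (hm : m < a + b) :
    0 ≤ (squareCorner a b m).2 ∧ (squareCorner a b m).2 + 1 ≤ a := by
  have : m * a / (a + b) < a := by
    rw [Nat.div_lt_iff_lt_mul (by omega), mul_comm a]
    exact Nat.mul_lt_mul_of_pos_right hm ha
  simp only [squareCorner]
  generalize m * a / (a + b) = Y at *
  omega

theorem squareCorner_add (a b m : ℕ) :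
    (squareCorner a b m).1 + (squareCorner a b m).2 + 1 = m := by
  simp only [squareCorner]
  ring

theorem squareCorner_le {a b m m' : ℕ} (h : m < m') :
    (squareCorner a b m).2 < (squareCorner a b m').2 ∨
      (squareCorner a b m).1 < (squareCorner a b m').1 := by
  have : m * a / (a + b) ≤ m' * a / (a + b) :=
    Nat.div_le_div_right (Nat.mul_le_mul_right a h.le)
  simp only [squareCorner]
  omega

/-- The two inequalities say that the residue lies between 0 and `a + b - 1`, which determines the
quotient. -/
theorem squareCorner_eq_of_bounds {a b : ℕ} {x y : ℤ} {m : ℕ} (hm : x + y + 1 = m)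
    (h1 : b * y ≤ a * x + a) (h2 : a * x < b * y + b) : squareCorner a b m = (x, y) := by
  have hc : (0 : ℤ) < (a + b : ℕ) := by
    by_contra h
    obtain rfl : a = 0 := by omega
    obtain rfl : b = 0 := by omega
    simp at h2
  have : ((m * a / (a + b) : ℕ) : ℤ) = y := by
    have hma : ((m * a : ℕ) : ℤ) = (x + y + 1) * a := by rw [hm]; push_cast; ring
    rw [Int.natCast_ediv, hma]
    refine le_antisymm (Int.lt_add_one_iff.1 (Int.ediv_lt_of_lt_mul hc ?_))
      (Int.le_ediv_of_mul_le hc ?_) <;> push_cast <;> linarith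
  simp only [squareCorner, this]
  ext
  · simp; omega
  · rfl


/-! ### The itinerary of the shifted segment -/

section Segment

variable {a b : ℕ} {ε : ℝ}

theorem shiftedSegment_lt_iff_snd (ha : 0 < a) {τ τ' : ℝ} :
    (shiftedSegment a b ε τ).2 < (shiftedSegment a b ε τ').2 ↔ τ < τ' := by
  simp only [shiftedSegment]
  exact mul_lt_mul_iff_left₀ (by exact_mod_cast ha)

theorem shiftedSegment_lt_iff_fst (hb : 0 < b) {τ τ' : ℝ} :
    (shiftedSegment a b ε τ).1 < (shiftedSegment a b ε τ').1 ↔ τ < τ' := by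
  simp only [shiftedSegment, sub_lt_sub_iff_right]
  exact mul_lt_mul_iff_left₀ (by exact_mod_cast hb)

theorem shiftedSegment_lt_of_add (ha : 0 < a) (hb : 0 < b) {τ τ' : ℝ}
    (h : (shiftedSegment a b ε τ).1 + (shiftedSegment a b ε τ).2 <
      (shiftedSegment a b ε τ').1 + (shiftedSegment a b ε τ').2) : τ < τ' := by
  by_contra hle
  have h1 := mt (shiftedSegment_lt_iff_fst (a := a) (ε := ε) hb (τ := τ) (τ' := τ')).1 hle
  have h2 := mt (shiftedSegment_lt_iff_snd (b := b) (ε := ε) ha (τ := τ) (τ' := τ')).1 hle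
  linarith

/-- Every cell through which the segment passes is in the list. -/
theorem mem_itinerary (ha : 0 < a) (hb : 0 < b) (hε : 0 < ε) (haε : a * ε < 1) {c : Cell}
    (h : (passTimes a b ε c).Nonempty) : c ∈ itinerary a b := by
  obtain ⟨τ, h0, h1, hmem⟩ := h
  obtain ⟨hx, hx', hy, hy'⟩ := Cell.bounds_of_mem hmem
  have ha' : (0 : ℝ) < a := by exact_mod_cast ha
  have hb' : (0 : ℝ) < b := by exact_mod_cast hb
  have ha1 : (1 : ℝ) ≤ a := by exact_mod_cast ha
  have haε0 : 0 < a * ε := by positivity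
  have hε1 : ε < 1 := by nlinarith
  obtain ⟨x, y, hcor⟩ : ∃ x y, c.corner = (x, y) := ⟨_, _, rfl⟩
  rw [hcor] at hx hx' hy hy'
  simp only [shiftedSegment] at hx hx' hy hy'
  have hy0 : 0 ≤ y := by
    have : (-1 : ℝ) < y := by nlinarith
    have : (-1 : ℤ) < y := by exact_mod_cast this
    omega
  have hy1 : y < a := by
    have : (y : ℝ) < a := by nlinarith
    exact_mod_cast this
  have hx0 : -1 ≤ x := by
    have : (-2 : ℝ) < x := by nlinarith
    have : (-2 : ℤ) < x := by exact_mod_cast this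
    omega
  have hx1 : x < b := by
    have : (x : ℝ) < b := by nlinarith
    exact_mod_cast this
  have e1 : b * (y : ℝ) ≤ b * (τ * a) := mul_le_mul_of_nonneg_left hy hb'.le
  have e2 : b * (τ * a) < b * ((y : ℝ) + 1) := mul_lt_mul_of_pos_left hy' hb'
  have e3 : a * (x : ℝ) ≤ a * (τ * b - ε) := mul_le_mul_of_nonneg_left hx ha'.le
  have e4 : a * (τ * b - ε) < a * ((x : ℝ) + 1) := mul_lt_mul_of_pos_left hx' ha'
  -- The shift costs `a * ε < 1`, which integrality absorbs.
  have f1 : b * y ≤ a * x + a := by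
    have : (b : ℝ) * y < a * x + a + 1 := by linarith
    have : (b : ℤ) * y < a * x + a + 1 := by exact_mod_cast this
    omega
  have f2 : a * x < b * y + b := by
    have : (a : ℝ) * x < b * y + b := by linarith
    exact_mod_cast this
  obtain ⟨m, hm⟩ := Int.eq_ofNat_of_zero_le (show 0 ≤ x + y + 1 by omega)
  have hcorner := squareCorner_eq_of_bounds hm f1 f2
  have hres := residue_eq a b m
  refine List.mem_flatMap.2 ⟨m, List.mem_range.2 (by omega), ?_⟩
  rw [hcorner] at hres
  simp only [squareCells, hcorner, List.mem_cons, List.not_mem_nil, or_false]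
  cases c with
  | horizontal x' y' =>
    obtain ⟨rfl, rfl⟩ := Prod.mk.inj hcor
    left
    simp only [Cell.points, shiftedSegment, Set.mem_ofPred_eq] at hmem
    have : (a : ℝ) * x' < b * y' := by
      rw [← hmem.1]
      have := mul_lt_mul_of_pos_left hmem.2.1 ha'
      linarith
    have : (a : ℤ) * x' < b * y' := by exact_mod_cast this
    rw [if_pos]
    have : ((m * a % (a + b) : ℕ) : ℤ) < a := by linarith
    exact_mod_cast this
  | vertical x' y' =>
    obtain ⟨rfl, rfl⟩ := Prod.mk.inj hcor
    left
    simp only [Cell.points, shiftedSegment, Set.mem_ofPred_eq] at hmem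
    have : (b : ℝ) * y' < a * x' + 1 := by
      rw [← hmem.1]
      have := mul_lt_mul_of_pos_left hmem.2.1 hb'
      linarith
    have : (b : ℤ) * y' < a * x' + 1 := by exact_mod_cast this
    rw [if_neg]
    have : (a : ℤ) ≤ ((m * a % (a + b) : ℕ) : ℤ) := by linarith
    exact not_lt.2 (by exact_mod_cast this)
  | lowerTriangle x' y' => obtain ⟨rfl, rfl⟩ := Prod.mk.inj hcor; simp
  | diagonal x' y' => obtain ⟨rfl, rfl⟩ := Prod.mk.inj hcor; simp
  | upperTriangle x' y' => obtain ⟨rfl, rfl⟩ := Prod.mk.inj hcor; simp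

theorem shiftedSegment_midpoint (τ τ' : ℝ) : shiftedSegment a b ε ((τ + τ') / 2) =
    (((shiftedSegment a b ε τ).1 + (shiftedSegment a b ε τ').1) / 2,
      ((shiftedSegment a b ε τ).2 + (shiftedSegment a b ε τ').2) / 2) := by
  simp only [shiftedSegment, Prod.mk.injEq]
  constructor <;> ring

/-- The segment passes through every cell in the list. -/
theorem passTimes_nonempty (ha : 0 < a) (hb : 0 < b) (hε : 0 < ε) (haε : a * ε < 1) {c : Cell}
    (h : c ∈ itinerary a b) : (passTimes a b ε c).Nonempty := by
  obtain ⟨m, hm, h⟩ := List.mem_flatMap.1 h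
  rw [List.mem_range] at hm
  obtain ⟨hy0, hy1⟩ := squareCorner_bounds ha hm
  have hmxy := squareCorner_add a b m
  have hres := residue_eq a b m
  have hlt := residue_lt (b := b) ha m
  simp only [squareCells, List.mem_cons, List.not_mem_nil, or_false] at h
  generalize m * a % (a + b) = d at *
  obtain ⟨x, y, hxy⟩ : ∃ x y, squareCorner a b m = (x, y) := ⟨_, _, rfl⟩
  rw [hxy] at h hy0 hy1 hmxy hres
  simp only at h hy0 hy1 hmxy hres
  have ha' : (0 : ℝ) < a := by exact_mod_cast ha
  have hb' : (0 : ℝ) < b := by exact_mod_cast hb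
  have ha1 : (1 : ℝ) ≤ a := by exact_mod_cast ha
  have haε0 : 0 < a * ε := by positivity
  have hε1 : ε < 1 := by nlinarith
  have hy0' : (0 : ℝ) ≤ y := by exact_mod_cast hy0
  have hy1' : (y : ℝ) + 1 ≤ a := by exact_mod_cast hy1
  have f1 : (b : ℝ) * y ≤ a * x + a := by
    have : (b : ℤ) * y ≤ a * x + a := by linarith [Int.natCast_nonneg d]
    exact_mod_cast this
  have f2 : (a : ℝ) * x + 1 ≤ b * y + b := by
    have : (a : ℤ) * x + 1 ≤ b * y + b := by
      have : (d : ℤ) + 1 ≤ a + b := by exact_mod_cast hlt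
      linarith
    exact_mod_cast this
  have hm' : (x : ℝ) + y + 1 = m := by exact_mod_cast hmxy
  have hmc : (m : ℝ) + 1 ≤ a + b := by exact_mod_cast hm
  have hab : (0 : ℝ) < a + b := by positivity
  obtain ⟨τ₁, hτ₁, hτ₁', hin⟩ : (passTimes a b ε
      (if d < a then .horizontal x y else .vertical x y)).Nonempty := by
    split_ifs with hd
    · have hd' : (a : ℝ) * x + 1 ≤ b * y := by
        have : (a : ℤ) * x + 1 ≤ b * y := by
          have : (d : ℤ) + 1 ≤ a := by exact_mod_cast hd
          linarith
        exact_mod_cast this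
      refine ⟨y / a, by positivity, by rw [div_lt_one ha']; linarith, ?_⟩
      simp only [Cell.points, shiftedSegment, Set.mem_ofPred_eq]
      refine ⟨by field_simp, ?_, ?_⟩
      · rw [lt_sub_iff_add_lt, div_mul_eq_mul_div, lt_div_iff₀ ha']
        linarith
      · rw [sub_lt_iff_lt_add, div_mul_eq_mul_div, div_lt_iff₀ ha']
        linarith
    · have hd' : (b : ℝ) * y ≤ a * x := by
        have : (b : ℤ) * y ≤ a * x := by
          have : (a : ℤ) ≤ d := by exact_mod_cast not_lt.1 hd
          linarith
        exact_mod_cast this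
      have hx0 : (0 : ℝ) ≤ x := by
        have : 0 ≤ a * (x : ℝ) := le_trans (by positivity) hd'
        exact nonneg_of_mul_nonneg_right this ha'
      have hx1 : (x : ℝ) + 1 ≤ b := by
        have : (x : ℝ) < b := by nlinarith
        have : x < b := by exact_mod_cast this
        exact_mod_cast this
      refine ⟨(x + ε) / b, by positivity, by rw [div_lt_one hb']; linarith, ?_⟩
      simp only [Cell.points, shiftedSegment, Set.mem_ofPred_eq]
      refine ⟨by field_simp; ring, ?_, ?_⟩
      · rw [div_mul_eq_mul_div, lt_div_iff₀ hb']
        linarith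
      · rw [div_mul_eq_mul_div, div_lt_iff₀ hb']
        linarith
  obtain ⟨τ₂, hτ₂, hτ₂', hdiag⟩ : (passTimes a b ε (.diagonal x y)).Nonempty := by
    have hm0 : (0 : ℝ) ≤ m := Nat.cast_nonneg m
    refine ⟨(m + ε) / (a + b), by positivity, by rw [div_lt_one hab]; linarith, ?_⟩
    simp only [Cell.points, shiftedSegment, Set.mem_ofPred_eq]
    refine ⟨by rw [← hm']; field_simp; ring, ?_, ?_⟩
    · rw [lt_sub_iff_add_lt, div_mul_eq_mul_div, lt_div_iff₀ hab, ← hm']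
      linarith
    · rw [sub_lt_iff_lt_add, div_mul_eq_mul_div, div_lt_iff₀ hab, ← hm']
      nlinarith
  -- Where the segment leaves the square: through the right side if `d < b`, through the top
  -- otherwise. The value 1 is allowed, because only the midpoint of `τ₂` and `τ₃` is used.
  obtain ⟨τ₃, hτ₃, hout⟩ : ∃ τ₃ : ℝ, τ₃ ≤ 1 ∧ (x : ℝ) < (shiftedSegment a b ε τ₃).1 ∧
      (shiftedSegment a b ε τ₃).1 ≤ x + 1 ∧ (y : ℝ) < (shiftedSegment a b ε τ₃).2 ∧
      (shiftedSegment a b ε τ₃).2 ≤ y + 1 ∧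
      (x : ℝ) + y + 1 < (shiftedSegment a b ε τ₃).1 + (shiftedSegment a b ε τ₃).2 := by
    rcases lt_or_ge d b with hd | hd
    · have hd' : (a : ℝ) * x + a + 1 ≤ b * y + b := by
        have : (a : ℤ) * x + a + 1 ≤ b * y + b := by
          have : (d : ℤ) + 1 ≤ b := by exact_mod_cast hd
          linarith
        exact_mod_cast this
      have hx1 : (x : ℝ) + 1 + 1 ≤ b := by
        have : (x : ℝ) + 1 < b := by nlinarith
        have : x + 1 < b := by exact_mod_cast this
        exact_mod_cast this
      have hfst : (shiftedSegment a b ε ((x + 1 + ε) / b)).1 = x + 1 := by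
        simp only [shiftedSegment]
        field_simp
        ring
      have hsnd : (y : ℝ) < (shiftedSegment a b ε ((x + 1 + ε) / b)).2 := by
        simp only [shiftedSegment]
        rw [div_mul_eq_mul_div, lt_div_iff₀ hb']
        linarith
      have hsnd' : (shiftedSegment a b ε ((x + 1 + ε) / b)).2 ≤ y + 1 := by
        simp only [shiftedSegment]
        rw [div_mul_eq_mul_div, div_le_iff₀ hb']
        linarith
      refine ⟨(x + 1 + ε) / b, by rw [div_le_one hb']; linarith, ?_, ?_, hsnd, hsnd', ?_⟩ <;>
        rw [hfst] <;> linarith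
    · have hd' : (b : ℝ) * y + b ≤ a * x + a := by
        have : (b : ℤ) * y + b ≤ a * x + a := by
          have : (b : ℤ) ≤ d := by exact_mod_cast hd
          linarith
        exact_mod_cast this
      have hsnd : (shiftedSegment a b ε ((y + 1) / a)).2 = y + 1 := by
        simp only [shiftedSegment]
        field_simp
      have hfst : (x : ℝ) < (shiftedSegment a b ε ((y + 1) / a)).1 := by
        simp only [shiftedSegment]
        rw [lt_sub_iff_add_lt, div_mul_eq_mul_div, lt_div_iff₀ ha']
        linarith
      have hfst' : (shiftedSegment a b ε ((y + 1) / a)).1 ≤ x + 1 := by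
        simp only [shiftedSegment]
        rw [sub_le_iff_le_add, div_mul_eq_mul_div, div_le_iff₀ ha']
        linarith
      refine ⟨(y + 1) / a, by rw [div_le_one ha']; linarith, hfst, hfst', ?_, ?_, ?_⟩ <;>
        rw [hsnd] <;> linarith
  have hdiag' := hdiag
  simp only [Cell.points, Set.mem_ofPred_eq] at hdiag'
  rcases h with rfl | rfl | rfl | rfl
  · exact ⟨τ₁, hτ₁, hτ₁', hin⟩
  · refine ⟨(τ₁ + τ₂) / 2, by linarith, by linarith, ?_⟩
    rw [shiftedSegment_midpoint]
    split_ifs at hin <;> simp only [Cell.points, Set.mem_ofPred_eq] at hin ⊢ <;>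
      refine ⟨?_, ?_, ?_⟩ <;> linarith
  · exact ⟨τ₂, hτ₂, hτ₂', hdiag⟩
  · have h23 : τ₂ < τ₃ := shiftedSegment_lt_of_add ha hb (by rw [hdiag'.1]; exact hout.2.2.2.2)
    refine ⟨(τ₂ + τ₃) / 2, by linarith, by linarith, ?_⟩
    rw [shiftedSegment_midpoint]
    simp only [Cell.points, Set.mem_ofPred_eq]
    refine ⟨?_, ?_, ?_⟩ <;> linarith

theorem isItinerary_itinerary (ha : 0 < a) (hb : 0 < b) (hε : 0 < ε) (haε : a * ε < 1) :
    IsItinerary a b ε (itinerary a b) := by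
  refine ⟨fun c => ⟨passTimes_nonempty ha hb hε haε, mem_itinerary ha hb hε haε⟩, ?_⟩
  rw [itinerary, List.pairwise_flatMap]
  constructor
  · intro m _
    rw [squareCells]
    generalize (squareCorner a b m).1 = x
    generalize (squareCorner a b m).2 = y
    have hentry : ∀ τ ∈ passTimes a b ε
        (if m * a % (a + b) < a then .horizontal x y else .vertical x y),
        ∀ τ', (x : ℝ) < (shiftedSegment a b ε τ').1 → (y : ℝ) < (shiftedSegment a b ε τ').2 →
          τ < τ' := by
      rintro τ ⟨-, -, hτ⟩ τ' hx hy
      split_ifs at hτ <;> simp only [Cell.points, Set.mem_ofPred_eq] at hτ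
      · exact (shiftedSegment_lt_iff_snd (b := b) (ε := ε) ha).1 (by linarith)
      · exact (shiftedSegment_lt_iff_fst (a := a) (ε := ε) hb).1 (by linarith)
    simp only [List.pairwise_cons, List.mem_cons, List.not_mem_nil, or_false, forall_eq_or_imp,
      forall_eq, List.Pairwise.nil, and_true, IsEmpty.forall_iff, implies_true]
    refine ⟨⟨?_, ?_, ?_⟩, ⟨?_, ?_⟩, ?_⟩
    · rintro τ hτ τ' ⟨-, -, hτ'⟩
      simp only [Cell.points, Set.mem_ofPred_eq] at hτ'
      exact hentry τ hτ τ' (by linarith) (by linarith)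
    · rintro τ hτ τ' ⟨-, -, hτ'⟩
      simp only [Cell.points, Set.mem_ofPred_eq] at hτ'
      exact hentry τ hτ τ' (by linarith) (by linarith)
    · rintro τ hτ τ' ⟨-, -, hτ'⟩
      simp only [Cell.points, Set.mem_ofPred_eq] at hτ'
      exact hentry τ hτ τ' (by linarith) (by linarith)
    all_goals
      rintro τ ⟨-, -, hτ⟩ τ' ⟨-, -, hτ'⟩
      simp only [Cell.points, Set.mem_ofPred_eq] at hτ hτ'
      exact shiftedSegment_lt_of_add ha hb (by linarith)
  -- A later square lies strictly higher or strictly further right, and the segment increases in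
  -- both coordinates.
  · refine List.pairwise_lt_range.imp fun {m m'} hmm c hc c' hc' τ hτ τ' hτ' => ?_
    have h := Cell.bounds_of_mem hτ.2.2
    have h' := Cell.bounds_of_mem hτ'.2.2
    rw [corner_eq_of_mem_squareCells hc] at h
    rw [corner_eq_of_mem_squareCells hc'] at h'
    rcases squareCorner_le (a := a) (b := b) hmm with hlt | hlt
    · have : ((squareCorner a b m).2 : ℝ) + 1 ≤ (squareCorner a b m').2 := by exact_mod_cast hlt
      exact (shiftedSegment_lt_iff_snd (b := b) (ε := ε) ha).1 (by linarith)
    · have : ((squareCorner a b m).1 : ℝ) + 1 ≤ (squareCorner a b m').1 := by exact_mod_cast hlt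
      exact (shiftedSegment_lt_iff_fst (a := a) (ε := ε) hb).1 (by linarith)

theorem IsItinerary.nodup {l : List Cell} (h : IsItinerary a b ε l) : l.Nodup := by
  refine h.2.imp_of_mem ?_
  rintro c d hc - hcd rfl
  obtain ⟨τ, hτ⟩ := (h.1 c).1 hc
  exact lt_irrefl _ (hcd τ hτ τ hτ)

theorem IsItinerary.unique {l l' : List Cell} (h : IsItinerary a b ε l)
    (h' : IsItinerary a b ε l') : l = l' := by
  refine List.Perm.eq_of_pairwise ?_ h.2 h'.2
    ((List.perm_ext_iff_of_nodup h.nodup h'.nodup).2 fun c => (h.1 c).trans (h'.1 c).symm)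
  intro c d hc hd hcd hdc
  obtain ⟨τ, hτ⟩ := (h.1 c).1 hc
  obtain ⟨τ', hτ'⟩ := (h'.1 d).1 hd
  exact absurd (hcd τ hτ τ' hτ') (hdc τ' hτ' τ hτ).not_gt

end Segment
/-! ### The signs of the crossed cells -/

section Signs

variable {a b : ℕ}

/-- The signs given to the entry edge and to the lower triangle of the square of residue `d`. -/
def entrySigns (kH kV a b d : ℕ) : List Bool :=
  (if d < a then List.replicate kH (decide (a ≤ 2 * d))
    else List.replicate kV (decide (2 * a + b ≤ 2 * d))) ++ [decide (a ≤ d)]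

/-- The signs given to the diagonal edge and to the upper triangle of the square of
residue `d`. -/
def exitSigns (kD a b d : ℕ) : List Bool :=
  List.replicate kD (decide (a + b ≤ 2 * d)) ++ [decide (b ≤ d)]

/-- The sign word of the fraction `a / b`. -/
def signWord (kH kD kV a b : ℕ) : List Bool :=
  (List.range (a + b)).flatMap fun m =>
    entrySigns kH kV a b (m * a % (a + b)) ++ exitSigns kD a b (m * a % (a + b))

/-- Values of `side` at lattice points are integers minus `a * ε`, so their signs do not depend on a
small `ε`. -/
theorem int_pos_iff_of_shift {z : ℤ} {δ : ℝ} (h0 : 0 < δ) (h1 : δ < 1) {x : ℝ}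
    (hx : x = z - δ) : 0 < x ↔ 0 < z := by
  rw [hx, sub_pos]
  constructor
  · intro h
    exact_mod_cast h0.trans h
  · intro h
    have : (1 : ℝ) ≤ z := by exact_mod_cast h
    linarith

theorem neg_iff_int_nonpos_of_shift {z : ℤ} {δ : ℝ} (h0 : 0 < δ) (h1 : δ < 1) {x : ℝ}
    (hx : 2 * x = z - δ) : x < 0 ↔ z ≤ 0 := by
  constructor
  · intro h
    have : (z : ℝ) < 1 := by linarith
    have : z < 1 := by exact_mod_cast this
    omega
  · intro h
    have : (z : ℝ) ≤ 0 := by exact_mod_cast h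
    linarith

theorem flatMap_cellSigns_squareCells (k : Fin 3 → ℕ) (σ : Equiv.Perm (Fin 3)) {ε : ℝ}
    (ha : 0 < a) (hε : 0 < ε) (haε : 2 * (a * ε) < 1) (m : ℕ) :
    (squareCells a b m).flatMap (cellSigns k σ a b ε) =
      entrySigns (k (σ 0)) (k (σ 2)) a b (m * a % (a + b)) ++
        exitSigns (k (σ 1)) a b (m * a % (a + b)) := by
  have hres := residue_eq a b m
  have hlt := residue_lt (b := b) ha m
  rw [squareCells]
  generalize (squareCorner a b m).1 = x at *
  generalize (squareCorner a b m).2 = y at *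
  generalize m * a % (a + b) = d at *
  have ha' : (0 : ℝ) < a := by exact_mod_cast ha
  have h0 : 0 < a * ε := by positivity
  have h20 : 0 < 2 * (a * ε) := by positivity
  have h1 : a * ε < 1 := by linarith
  have hres' : (d : ℝ) = a * (x + 1) - b * y := by exact_mod_cast hres
  have hH : edgeSign a b ε ((x : ℝ) + 1 / 2, (y : ℝ)) = decide (a ≤ 2 * d) := by
    rw [edgeSign, decide_eq_decide, neg_iff_int_nonpos_of_shift (z := a - 2 * d) h20 haε]
    · omega
    · simp only [side]; push_cast; linarith
  have hV : edgeSign a b ε ((x : ℝ), (y : ℝ) + 1 / 2) = decide (2 * a + b ≤ 2 * d) := by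
    rw [edgeSign, decide_eq_decide, neg_iff_int_nonpos_of_shift (z := 2 * a + b - 2 * d) h20 haε]
    · omega
    · simp only [side]; push_cast; linarith
  have hD : edgeSign a b ε ((x : ℝ) + 1 / 2, (y : ℝ) + 1 / 2) = decide (a + b ≤ 2 * d) := by
    rw [edgeSign, decide_eq_decide, neg_iff_int_nonpos_of_shift (z := a + b - 2 * d) h20 haε]
    · omega
    · simp only [side]; push_cast; linarith
  -- The upper left corner is always on the left and the lower right one never, so each triangle
  -- sign is decided by its third vertex.
  have s00 : 0 < side a b ε ((x : ℝ), (y : ℝ)) ↔ d < a := by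
    rw [int_pos_iff_of_shift (z := a - d) h0 h1]
    · omega
    · simp only [side]; push_cast; linarith
  have s10 : ¬ 0 < side a b ε ((x : ℝ) + 1, (y : ℝ)) := by
    rw [int_pos_iff_of_shift (z := -d) h0 h1]
    · omega
    · simp only [side]; push_cast; linarith
  have s01 : 0 < side a b ε ((x : ℝ), (y : ℝ) + 1) := by
    rw [int_pos_iff_of_shift (z := a + b - d) h0 h1]
    · omega
    · simp only [side]; push_cast; linarith
  have s11 : 0 < side a b ε ((x : ℝ) + 1, (y : ℝ) + 1) ↔ d < b := by
    rw [int_pos_iff_of_shift (z := b - d) h0 h1]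
    · omega
    · simp only [side]; push_cast; linarith
  have hL : triangleSign a b ε ((x : ℝ), (y : ℝ)) ((x : ℝ) + 1, (y : ℝ)) ((x : ℝ), (y : ℝ) + 1) =
      decide (a ≤ d) := by
    rw [triangleSign, decide_eq_decide]
    by_cases hd : d < a
    · simp [s00, s10, s01, hd]
    · simp [s00, s10, s01, hd, not_lt.1 hd]
  have hU : triangleSign a b ε ((x : ℝ) + 1, (y : ℝ)) ((x : ℝ), (y : ℝ) + 1)
      ((x : ℝ) + 1, (y : ℝ) + 1) = decide (b ≤ d) := by
    rw [triangleSign, decide_eq_decide]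
    by_cases hd : d < b
    · simp [s11, s10, s01, hd]
    · simp [s11, s10, s01, hd, not_lt.1 hd]
  have hE : cellSigns k σ a b ε (if d < a then .horizontal x y else .vertical x y) =
      if d < a then List.replicate (k (σ 0)) (decide (a ≤ 2 * d))
        else List.replicate (k (σ 2)) (decide (2 * a + b ≤ 2 * d)) := by
    split_ifs
    · rw [cellSigns, hH]
    · rw [cellSigns, hV]
  rw [List.flatMap_cons, hE]
  simp only [List.flatMap_cons, List.flatMap_nil, cellSigns, hD, hL, hU, entrySigns, exitSigns,
    List.append_assoc, List.append_nil]

theorem flatMap_cellSigns_itinerary (k : Fin 3 → ℕ) (σ : Equiv.Perm (Fin 3)) {ε : ℝ}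
    (ha : 0 < a) (hε : 0 < ε) (haε : 2 * (a * ε) < 1) :
    (itinerary a b).flatMap (cellSigns k σ a b ε) =
      signWord (k (σ 0)) (k (σ 1)) (k (σ 2)) a b := by
  rw [itinerary, List.flatMap_assoc, signWord]
  simp only [flatMap_cellSigns_squareCells k σ ha hε haε]

open Filter Topology in
theorem isStronglyAdmissible_iff (k : Fin 3 → ℕ) (σ : Equiv.Perm (Fin 3)) (ha : 0 < a)
    (hb : 0 < b) (s : List ℕ) : IsStronglyAdmissible k σ (a, b) s ↔
      s = runLengths (signWord (k (σ 0)) (k (σ 1)) (k (σ 2)) a b) := by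
  rw [IsStronglyAdmissible, if_neg ha.ne', if_neg hb.ne']
  dsimp only
  have ha' : (0 : ℝ) < a := by exact_mod_cast ha
  have hev : ∀ᶠ ε : ℝ in 𝓝[>] 0, 0 < ε ∧ 2 * (a * ε) < 1 := by
    filter_upwards [Ioo_mem_nhdsGT (show (0 : ℝ) < 1 / (2 * a) by positivity)] with ε hε
    refine ⟨hε.1, ?_⟩
    have := hε.2
    rw [lt_div_iff₀ (by positivity)] at this
    linarith
  constructor
  · intro h
    obtain ⟨ε, ⟨l, hl, rfl⟩, hε, haε⟩ := (h.and hev).exists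
    have h0 : 0 < a * ε := by positivity
    rw [hl.unique (isItinerary_itinerary ha hb hε (by linarith)),
      flatMap_cellSigns_itinerary k σ ha hε haε]
  · rintro rfl
    filter_upwards [hev] with ε ⟨hε, haε⟩
    have h0 : 0 < a * ε := by positivity
    exact ⟨itinerary a b, isItinerary_itinerary ha hb hε (by linarith), by
      rw [flatMap_cellSigns_itinerary k σ ha hε haε]⟩

theorem signWord_head? (kH kD kV : ℕ) (ha : 0 < a) :
    (signWord kH kD kV a b).head? = some false := by
  obtain ⟨n, hn⟩ := Nat.exists_eq_add_of_lt (show 0 < a + b by omega)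
  rw [signWord, hn, zero_add, List.range_succ_eq_map, List.flatMap_cons]
  have : decide (a ≤ 0) = false := by simp [ha.ne']
  cases kH <;> simp [entrySigns, ha, ha.ne', List.replicate_succ]

theorem signWord_getLast? (kH kD kV : ℕ) (ha : 0 < a) :
    (signWord kH kD kV a b).getLast? = some true := by
  obtain ⟨n, hn⟩ := Nat.exists_eq_add_of_lt (show 0 < a + b by omega)
  have hmod : n * a % (a + b) = b := by
    refine mod_eq_of_int (Y := a - 1) ?_ (by omega)
    have : (n : ℤ) = a + b - 1 := by omega
    rw [this]
    push_cast
    ring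
  have hsplit : signWord kH kD kV a b = (List.range n).flatMap (fun m =>
      entrySigns kH kV a b (m * a % (a + b)) ++ exitSigns kD a b (m * a % (a + b))) ++
      (entrySigns kH kV a b b ++ exitSigns kD a b b) := by
    have hrange : List.range (a + b) = List.range n ++ [n] := by
      rw [hn, zero_add, List.range_succ]
    rw [signWord, hrange, List.flatMap_append]
    simp [hmod]
  rw [hsplit, exitSigns, ← List.append_assoc, ← List.append_assoc]
  simp

/-- If `d < b` the segment leaves through the right side and the next residue is `d + a`; otherwise
it leaves through the top and the next residue is `d - b`. -/
theorem wordMat_signs (kH kV : ℕ) (ha : 0 < a) (m : ℕ) :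
    signMat (decide (b ≤ m * a % (a + b))) *
      wordMat (entrySigns kH kV a b ((m + 1) * a % (a + b))) =
        sideLetter kH kV a b (m * a % (a + b)) := by
  have hlt := residue_lt (b := b) ha m
  have hma : (m * a : ℤ) = (a + b : ℕ) * ((m * a / (a + b) : ℕ) : ℤ) + (m * a % (a + b) : ℕ) := by
    exact_mod_cast (Nat.div_add_mod (m * a) (a + b)).symm
  generalize m * a % (a + b) = d at *
  generalize ((m * a / (a + b) : ℕ) : ℤ) = Y at *
  rw [entrySigns, wordMat_append, sideLetter]
  by_cases hd : d < b
  · rw [mod_eq_of_int (d := d + a) (Y := Y) (by push_cast at hma ⊢; linear_combination hma)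
      (by omega), if_neg (by omega), if_pos hd, wordMat_replicate]
    have e1 : ¬ b ≤ d := by omega
    have e2 : 2 * a + b ≤ 2 * (d + a) ↔ ¬ 2 * d < b := by omega
    simp only [e1, e2]
    split_ifs <;> simp_all [wordMat, signMat, mul_assoc]
  · rw [mod_eq_of_int (d := d - b) (Y := Y + 1)
      (by rw [Nat.cast_sub (by omega)]; push_cast at hma ⊢; linear_combination hma)
      (by omega), if_pos (by omega), if_neg hd, wordMat_replicate]
    have e1 : b ≤ d := by omega
    have e2 : a ≤ 2 * (d - b) ↔ ¬ 2 * d < a + 2 * b := by omega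
    have e3 : ¬ a ≤ d - b := by omega
    simp only [e1, e2, e3]
    split_ifs <;> simp_all [wordMat, signMat, mul_assoc]

theorem wordMat_signWord (kH kD kV : ℕ) (ha : 0 < a) :
    wordMat (signWord kH kD kV a b) * upMat (1 + kH) =
      upMat (1 + kH) * letterProd kH kD kV a b := by
  have hentry : wordMat (entrySigns kH kV a b 0) = upMat (1 + kH) := by
    rw [entrySigns, if_pos ha, wordMat_append, wordMat_replicate, if_neg (by simp [ha.ne'])]
    simp [wordMat, signMat, ha.ne', upMat_mul, add_comm]
  have hexit : ∀ d, wordMat (exitSigns kD a b d) =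
      diagLetter kD a b d * signMat (decide (b ≤ d)) := by
    intro d
    rw [exitSigns, wordMat_append, wordMat_replicate, diagLetter]
    by_cases h : 2 * d < a + b
    · simp [h, wordMat]
    · simp [h, not_lt.1 h, wordMat]
  have htel := seqProd_mul_telescope
    (fun m => wordMat (entrySigns kH kV a b (m * a % (a + b))))
    (fun m => wordMat (exitSigns kD a b (m * a % (a + b)))) (a + b)
  -- At `m = a + b` the residue is 0 again, so the factor at the end equals the one pulled out in
  -- front.
  simp only [zero_mul, Nat.zero_mod, Nat.mul_mod_right, hentry] at htel
  rw [signWord, wordMat_flatMap, list_prod_range_eq_seqProd]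
  simp only [wordMat_append]
  rw [htel, letterProd, seqProd_two_mul]
  congr 1
  refine seqProd_congr fun m _ => ?_
  rw [letter_even, letter_odd, hexit, mul_assoc, wordMat_signs kH kV ha]

theorem closedCohn_eq_wordMat (k : Fin 3 → ℕ) (σ : Equiv.Perm (Fin 3)) (ha : 0 < a) :
    closedCohn k σ (a, b) = wordMat (signWord (k (σ 0)) (k (σ 1)) (k (σ 2)) a b) := by
  rw [closedCohn, ← wordMat_signWord _ _ _ ha, mul_assoc, upMat_mul, add_neg_cancel, upMat_zero,
    mul_one]

end Signs

/-! ### Matching the two sides, including the fraction 1/0 -/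

theorem existsUnique_isStronglyAdmissible (k : Fin 3 → ℕ) (σ : Equiv.Perm (Fin 3)) {a : ℕ}
    (ha : 0 < a) (b : ℕ) : ∃! s, IsStronglyAdmissible k σ (a, b) s := by
  rcases Nat.eq_zero_or_pos b with rfl | hb
  · simp [IsStronglyAdmissible, ha.ne']
  · simp [isStronglyAdmissible_iff k σ ha hb]

theorem closedCohn_eq_cfMatrix (k : Fin 3 → ℕ) (σ : Equiv.Perm (Fin 3)) {a b : ℕ} (ha : 0 < a)
    (hab : Nat.Coprime a b) {s : List ℕ} (hs : IsStronglyAdmissible k σ (a, b) s) :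
    closedCohn k σ (a, b) = cfMatrix s := by
  rcases Nat.eq_zero_or_pos b with rfl | hb
  · obtain rfl : a = 1 := by simpa using hab
    obtain rfl : s = [1 + k (σ 0) + k (σ 1), 1] := by simpa [IsStronglyAdmissible] using hs
    simp [closedCohn, letterProd, seqProd, letter, diagLetter, sideLetter, upMat, loMat, cfMatrix]
    ring_nf
    simp
  · rw [(isStronglyAdmissible_iff k σ ha hb s).1 hs, closedCohn_eq_wordMat k σ ha,
      cfMatrix_runLengths _ (signWord_head? _ _ _ ha) (signWord_getLast? _ _ _ ha)]

end GenCohn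

theorem theorem4p3 (k : Fin 3 → ℕ) (σ : Equiv.Perm (Fin 3)) (a b : ℕ) (ha : 0 < a)
    (hab : Nat.Coprime a b) :
    (∃! M, GenCohn.IsCohnMatrix k σ (a, b) M) ∧
    (∃! s, GenCohn.IsStronglyAdmissible k σ (a, b) s) ∧
    ∀ M s, GenCohn.IsCohnMatrix k σ (a, b) M → GenCohn.IsStronglyAdmissible k σ (a, b) s →
      M = GenCohn.cfMatrix s :=
  ⟨GenCohn.existsUnique_isCohnMatrix k σ ha hab,
    GenCohn.existsUnique_isStronglyAdmissible k σ ha b,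
    fun _ _ hM hs => (GenCohn.isCohnMatrix_eq k σ hM).trans
      (GenCohn.closedCohn_eq_cfMatrix k σ ha hab hs)⟩
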